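/- **Setting.** Let $p,n,n_{\mathrm{el}}\ge 1$ be integers with $2^n=n_{\mathrm{el}}\,p+1$, and consider the one-dimensional mesh of $n_{\mathrm{el}}$ Lagrange elements of order $p$, whose $2^n$ nodes are numbered from left to right, so that local node $j\in\{0,\dots,p\}$ of element $e\in\{0,\dots,n_{\mathrm{el}}-1\}$ is the global node $\mathrm{IX}(j,e)=pe+j$. For $j,k\in\{0,\dots,p\}$ let $$\hat A_{jk}=\sum_{e=0}^{n_{\mathrm{el}}-1}|\mathrm{IX}(j,e)\rangle\langle \mathrm{IX}(k,e)|\in\mathbb C^{2^n\times 2^n}$$ be the units of interaction. Let $A^e\in\mathbb C^{(p+1)\times(p+1)}$, $A^e\neq 0$, be an elemental array that is the same for all elements, let $A=\sum_{j,k=0}^{p}A^e_{jk}\hat A_{jk}$ be the assembled global array, and put $m=\lceil\log_2(p+1)\rceil$. For $\alpha>0$, an $(\alpha,a)$-block-encoding of $A$ is a unitary $U$ on $a+n$ qubits with $A=\alpha\,(\langle 0^a|\otimes I)\,U\,(|0^a\rangle\otimes I)$. A "Toffoli or simpler" gate is a Toffoli gate, a CNOT gate, or an arbitrary one-qubit gate.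 A circuit of such gates implements $U$ if, possibly using additional work qubits, it maps $|\psi\rangle|0\cdots0\rangle$ to $(U|\psi\rangle)|0\cdots0\rangle$ for every state $|\psi\rangle$ of the $a+n$ qubits; such work qubits, which are returned to zero without post-selection, are not counted in $a$. **Theorem.** There is an absolute constant $C$ such that for all $n,p,n_{\mathrm{el}},A^e$ as above there is a $$\Bigl(\sum_{j,k=0}^{p}|A^e_{jk}|,\;4m+3\Bigr)\text{-block-encoding of }A$$ that is implemented by a circuit of at most $C\,n\,m\,(p+1)^2$ Toffoli or simpler gates. -/

import Mathlib

/-! ## Quantum circuits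

The qubits of a register are labelled by a finite type `Q`; the computational basis states
are the bit strings `Q → Fin 2`, and operators are complex matrices indexed by them. -/

/-- "Toffoli or simpler" gates on a register with qubits `Q`:
arbitrary one-qubit gates, CNOT gates and Toffoli gates. -/
inductive QGate (Q : Type) : Type
  /-- a one-qubit unitary `u` on the qubit `q` -/
  | single (q : Q) (u : Matrix.unitaryGroup (Fin 2) ℂ)
  /-- a NOT on the qubit `t`, controlled on `c` -/
  | cnot (c t : Q) (h : c ≠ t)
  /-- a NOT on the qubit `t`, controlled on `c₁` and `c₂` -/
  | toffoli (c₁ c₂ t : Q) (h₁ : c₁ ≠ c₂) (h₂ : c₁ ≠ t) (h₃ : c₂ ≠ t)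

/-- The matrix of a gate on the whole register; the entry `x y` is `⟨x| g |y⟩`. Addition and
multiplication of bits in `Fin 2` are XOR and AND. -/
noncomputable def QGate.toMatrix {Q : Type} [Fintype Q] [DecidableEq Q] :
    QGate Q → Matrix (Q → Fin 2) (Q → Fin 2) ℂ
  | .single q u => Matrix.of fun x y =>
      if x = Function.update y q (x q) then u.1 (x q) (y q) else 0
  | .cnot c t _ => Matrix.of fun x y =>
      if x = Function.update y t (y t + y c) then 1 else 0
  | .toffoli c₁ c₂ t _ _ _ => Matrix.of fun x y =>
      if x = Function.update y t (y t + y c₁ * y c₂) then 1 else 0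

/-- A circuit is a list of gates, the head of the list being applied first. Its gate count is
the length of the list. -/
abbrev QCircuit (Q : Type) : Type := List (QGate Q)

/-- The operator implemented by a circuit on the whole register. -/
noncomputable def QCircuit.toMatrix {Q : Type} [Fintype Q] [DecidableEq Q] :
    QCircuit Q → Matrix (Q → Fin 2) (Q → Fin 2) ℂ
  | [] => 1
  | g :: c => QCircuit.toMatrix c * g.toMatrix

/-- A circuit on the qubits `Q` together with `w` work qubits implements the operator `U` on `Q`
if it maps `|y⟩ |0^w⟩` to `(U |y⟩) |0^w⟩` for every basis state `y`: the work qubits start in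
the state zero and are restored to it, without any measurement. -/
def QCircuit.Implements {Q : Type} [Fintype Q] [DecidableEq Q] {w : ℕ}
    (c : QCircuit (Q ⊕ Fin w)) (U : Matrix (Q → Fin 2) (Q → Fin 2) ℂ) : Prop :=
  ∀ (x y : Q → Fin 2) (z : Fin w → Fin 2),
    QCircuit.toMatrix c (Sum.elim x z) (Sum.elim y 0) = if z = 0 then U x y else 0

/-! ## Block-encodings -/

/-- The basis state `|0^a⟩ |i⟩` of `a` ancilla qubits and `n` system qubits, where the integer
`i < 2 ^ n` is written in binary. -/
def zeroKet (a : ℕ) {n : ℕ} (i : Fin (2 ^ n)) : Fin a ⊕ Fin n → Fin 2 :=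
  Sum.elim 0 (finFunctionFinEquiv.symm i)

/-- `U` is an (exact) `(α, a)`-block-encoding of the `n`-qubit matrix `A`: `α > 0`, `U` is a
unitary on `a + n` qubits, and `A = α (⟨0^a| ⊗ I) U (|0^a⟩ ⊗ I)`. -/
def IsBlockEncoding (α : ℝ) (a : ℕ) {n : ℕ} (A : Matrix (Fin (2 ^ n)) (Fin (2 ^ n)) ℂ)
    (U : Matrix (Fin a ⊕ Fin n → Fin 2) (Fin a ⊕ Fin n → Fin 2) ℂ) : Prop :=
  0 < α ∧ U ∈ Matrix.unitaryGroup (Fin a ⊕ Fin n → Fin 2) ℂ ∧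
    A = (α : ℂ) • U.submatrix (zeroKet a) (zeroKet a)

/-! ## Assembly of finite element arrays -/

/-- The unit of interaction `∑ₑ |IX(j,e)⟩⟨IX(k,e)|` between the local nodes `j` and `k`, for the
connectivity array `IX` of a mesh with `numel` elements of `nen` nodes each and `numnp` nodal
points in total. -/
noncomputable def unitOfInteraction {nen numel numnp : ℕ}
    (IX : Fin nen → Fin numel → Fin numnp) (j k : Fin nen) :
    Matrix (Fin numnp) (Fin numnp) ℂ :=
  ∑ e : Fin numel, Matrix.single (IX j e) (IX k e) 1

/-- The global array assembled from the constant elemental array `Ae`. -/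
noncomputable def globalArray {nen numel numnp : ℕ}
    (IX : Fin nen → Fin numel → Fin numnp) (Ae : Matrix (Fin nen) (Fin nen) ℂ) :
    Matrix (Fin numnp) (Fin numnp) ℂ :=
  ∑ j : Fin nen, ∑ k : Fin nen, Ae j k • unitOfInteraction IX j k

/-- The connectivity array of a one-dimensional mesh of `numel` Lagrange elements of order `p`.
Nodes and elements are numbered from left to right, and consecutive elements share an end node:
the local node `j` of the element `e` is the global node `p e + j`. -/
def lagrangeIX {p numel numnp : ℕ} (h : numnp = numel * p + 1)
    (j : Fin (p + 1)) (e : Fin numel) : Fin numnp :=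
  ⟨p * e + j, by
    have h1 : ((e : ℕ) + 1) * p ≤ numel * p := Nat.mul_le_mul_right p e.isLt
    have h2 := j.isLt
    nlinarith⟩

/-! Each unit of interaction is a restricted translation: it moves a node `i = p e + k` by `j - k`
and kills every node that is not local node `k` of some element. Translations modulo `2 ^ n` permute
the basis states. The restriction is obtained by raising a flag ancilla off the domain, since
projecting the ancillas on zero discards the flagged part.

The block-encoding is a linear combination of unitaries `Lᴴ * S * R`. Selection qubits hold a code
`s` of the pair `(j, k)`. `R` and `L` prepare unit vectors with amplitudes `v s` and `u s` such that
`α * conj (u s) * v s` is the coefficient coded by `s` (`exists_sqrt_coefficients`); both vectors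
can be normalised exactly when `α` is the sum of the absolute values. `S` flags and translates
without changing `s` (`select_eq_iff`), so only the diagonal terms in `s` survive (`exists_lcu`).

For the gate count, the `2 * m` selection qubits have at most `4 * (p + 1) ^ 2` basis states.
Amplitudes are prepared along a binary tree, at a cost linear in that number
(`exists_controlled_preparation`). The translation is a table lookup followed by a ripple-carry
addition (`computes_shift`). Membership in the domain is a congruence modulo `p` with an exception
at each end of the mesh (`exists_element_iff`), and residues are tracked bit by bit in a table with
`p` entries (`computes_residue`). These Boolean programs become circuits by computing, copying and
uncomputing (`implementable_xorOracle`, `implementable_perm`).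

Clean work qubits are handled by the relation `C * P = P * U`, where the isometry `P` appends zeros.
It is stable under products and adjoints, and it makes `U` unitary. -/

open Matrix

set_option linter.unusedSectionVars false

/-! ## Matrices of functions and basis vectors -/

/-- The matrix sending the basis vector `x` to the basis vector `f x`. -/
def funMatrix {X Y : Type} [DecidableEq Y] (f : X → Y) : Matrix Y X ℂ :=
  Matrix.of fun y x => if y = f x then 1 else 0

/-- The basis vector of `x`. -/
def ket {X : Type} [DecidableEq X] (x : X) : X → ℂ := Pi.single x 1

section Kets

variable {X Y Z : Type} [Fintype X] [DecidableEq X] [Fintype Y] [DecidableEq Y]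
  [Fintype Z] [DecidableEq Z]

theorem ket_apply (x y : X) : ket x y = if y = x then 1 else 0 := by
  simp [ket, Pi.single_apply]

theorem mulVec_ket (M : Matrix Y X ℂ) (x : X) (y : Y) : (M *ᵥ ket x) y = M y x := by
  simp [ket]

theorem ext_ket {M N : Matrix Y X ℂ} (h : ∀ x, M *ᵥ ket x = N *ᵥ ket x) : M = N := by
  ext y x
  rw [← mulVec_ket M, h, mulVec_ket]

theorem funMatrix_mulVec_ket (f : X → Y) (x : X) : funMatrix f *ᵥ ket x = ket (f x) := by
  ext y
  rw [mulVec_ket, ket_apply, funMatrix, of_apply]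

theorem funMatrix_mul (f : Y → Z) (g : X → Y) :
    funMatrix f * funMatrix g = funMatrix (f ∘ g) := by
  apply ext_ket
  intro x
  simp [← mulVec_mulVec, funMatrix_mulVec_ket]

theorem eq_funMatrix {M : Matrix Y X ℂ} {f : X → Y} (h : ∀ x, M *ᵥ ket x = ket (f x)) :
    M = funMatrix f :=
  ext_ket fun x => by rw [h, funMatrix_mulVec_ket]

theorem funMatrix_conjTranspose_of_involutive {f : X → X} (h : Function.Involutive f) :
    (funMatrix f)ᴴ = funMatrix f := by
  ext x y
  have : y = f x ↔ x = f y := by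
    constructor
    · rintro rfl; exact (h x).symm
    · rintro rfl; exact (h y).symm
  simp [funMatrix, conjTranspose_apply, this]

theorem conjTranspose_funMatrix_mul {f : X → Y} (h : Function.Injective f) :
    (funMatrix f)ᴴ * funMatrix f = 1 := by
  ext x y
  simp [funMatrix, Matrix.mul_apply, conjTranspose_apply, Matrix.one_apply, h.eq_iff, eq_comm]

theorem mulVec_ket_of_unitary {M : Matrix X X ℂ} (hM : Mᴴ * M = 1) {x y : X}
    (h : M *ᵥ ket x = ket y) : Mᴴ *ᵥ ket y = ket x := by
  rw [← h, mulVec_mulVec, hM, one_mulVec]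

end Kets

/-! ## Actions of gates and circuits -/

section Gates

variable {Q R : Type} [Fintype Q] [DecidableEq Q] [Fintype R] [DecidableEq R]

theorem QGate.single_ket (q : Q) (u : Matrix.unitaryGroup (Fin 2) ℂ) (y : Q → Fin 2) :
    (QGate.single q u).toMatrix *ᵥ ket y =
      ∑ b, u.1 b (y q) • ket (Function.update y q b) := by
  ext x
  rw [mulVec_ket, QGate.toMatrix, of_apply, Finset.sum_apply]
  simp only [Pi.smul_apply, ket_apply, smul_eq_mul, mul_ite, mul_one, mul_zero]
  rw [Finset.sum_eq_single (x q)]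
  · intro b _ hb
    rw [if_neg]
    rintro rfl
    simp at hb
  · simp

theorem QGate.cnot_ket (c t : Q) (h : c ≠ t) (y : Q → Fin 2) :
    (QGate.cnot c t h).toMatrix *ᵥ ket y = ket (Function.update y t (y t + y c)) := by
  ext x
  rw [mulVec_ket, ket_apply, QGate.toMatrix, of_apply]

theorem QGate.toffoli_ket (c d t : Q) (h : c ≠ d) (h' : c ≠ t) (h'' : d ≠ t) (y : Q → Fin 2) :
    (QGate.toffoli c d t h h' h'').toMatrix *ᵥ ket y =
      ket (Function.update y t (y t + y c * y d)) := by
  ext x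
  rw [mulVec_ket, ket_apply, QGate.toMatrix, of_apply]

/-- The inverse of a gate. -/
noncomputable def QGate.inv : QGate Q → QGate Q
  | .single q u => .single q u⁻¹
  | .cnot c t h => .cnot c t h
  | .toffoli c d t h h' h'' => .toffoli c d t h h' h''

theorem fin2_add_self (a b : Fin 2) : a + b + b = a := by
  revert a b; decide

theorem QGate.inv_toMatrix (g : QGate Q) : g.inv.toMatrix = g.toMatrixᴴ := by
  cases g with
  | single q u =>
    ext x y
    simp only [QGate.inv, QGate.toMatrix, of_apply, conjTranspose_apply]
    have : x = Function.update y q (x q) ↔ y = Function.update x q (y q) := by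
      simp only [Function.eq_update_iff, true_and]
      exact forall₂_congr fun _ _ => eq_comm
    simp only [this]
    split_ifs
    · rfl
    · simp
  | cnot c t h =>
    have : (QGate.cnot c t h).toMatrix = funMatrix fun y => Function.update y t (y t + y c) :=
      eq_funMatrix (QGate.cnot_ket c t h)
    rw [QGate.inv, this, funMatrix_conjTranspose_of_involutive]
    intro y
    simp [Function.update_of_ne h, fin2_add_self]
  | toffoli c d t h h' h'' =>
    have : (QGate.toffoli c d t h h' h'').toMatrix =
        funMatrix fun y => Function.update y t (y t + y c * y d) :=
      eq_funMatrix (QGate.toffoli_ket c d t h h' h'')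
    rw [QGate.inv, this, funMatrix_conjTranspose_of_involutive]
    intro y
    simp [Function.update_of_ne h', Function.update_of_ne h'', fin2_add_self]

theorem QGate.inv_mul (g : QGate Q) : g.inv.toMatrix * g.toMatrix = 1 := by
  apply ext_ket
  intro y
  rw [← mulVec_mulVec, one_mulVec]
  cases g with
  | single q u =>
    rw [QGate.single_ket, mulVec_sum]
    simp only [mulVec_smul, QGate.inv, QGate.single_ket, Function.update_self,
      Function.update_idem, Finset.smul_sum, smul_smul]
    rw [Finset.sum_comm]
    simp only [← Finset.sum_smul]
    have h : ∀ b, ∑ a, u.1 a (y q) * (u⁻¹).1 b a = if b = y q then 1 else 0 := by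
      intro b
      have h1 : (u⁻¹).1 * u.1 = 1 := by
        have := inv_mul_cancel u
        exact congrArg Subtype.val this
      have h2 := congrFun (congrFun h1 b) (y q)
      rw [Matrix.mul_apply, Matrix.one_apply] at h2
      rw [← h2]
      exact Finset.sum_congr rfl fun _ _ => mul_comm _ _
    simp only [h, ite_smul, one_smul, zero_smul, Finset.sum_ite_eq', Finset.mem_univ, if_true,
      Function.update_eq_self]
  | cnot c t h =>
    simp [QGate.inv, QGate.cnot_ket, Function.update_of_ne h, fin2_add_self]
  | toffoli c d t h h' h'' =>
    simp [QGate.inv, QGate.toffoli_ket, Function.update_of_ne h', Function.update_of_ne h'',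
      fin2_add_self]

theorem QCircuit.toMatrix_nil : QCircuit.toMatrix ([] : QCircuit Q) = 1 := rfl

theorem QCircuit.toMatrix_cons (g : QGate Q) (c : QCircuit Q) :
    QCircuit.toMatrix (g :: c) = QCircuit.toMatrix c * g.toMatrix := rfl

theorem QCircuit.toMatrix_append (c d : QCircuit Q) :
    QCircuit.toMatrix (c ++ d) = QCircuit.toMatrix d * QCircuit.toMatrix c := by
  induction c with
  | nil => simp [QCircuit.toMatrix_nil]
  | cons g c ih =>
    rw [List.cons_append, QCircuit.toMatrix_cons, ih, QCircuit.toMatrix_cons, Matrix.mul_assoc]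

theorem QCircuit.toMatrix_singleton (g : QGate Q) :
    QCircuit.toMatrix [g] = g.toMatrix := by
  simp [QCircuit.toMatrix_cons, QCircuit.toMatrix_nil]

/-- The inverse of a circuit. -/
noncomputable def QCircuit.inv (c : QCircuit Q) : QCircuit Q := (c.map QGate.inv).reverse

theorem QCircuit.length_inv (c : QCircuit Q) : (QCircuit.inv c).length = c.length := by
  simp [QCircuit.inv]

theorem QCircuit.inv_toMatrix (c : QCircuit Q) :
    (QCircuit.inv c).toMatrix = (QCircuit.toMatrix c)ᴴ := by
  induction c with
  | nil => simp [QCircuit.inv, QCircuit.toMatrix_nil]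
  | cons g c ih =>
    rw [QCircuit.inv] at ih ⊢
    rw [List.map_cons, List.reverse_cons, QCircuit.toMatrix_append, ih,
      QCircuit.toMatrix_singleton, QGate.inv_toMatrix, QCircuit.toMatrix_cons,
      conjTranspose_mul]

theorem QCircuit.conjTranspose_mul_toMatrix (c : QCircuit Q) :
    (QCircuit.toMatrix c)ᴴ * QCircuit.toMatrix c = 1 := by
  induction c with
  | nil => simp [QCircuit.toMatrix_nil]
  | cons g c ih =>
    rw [QCircuit.toMatrix_cons, conjTranspose_mul, Matrix.mul_assoc, ← Matrix.mul_assoc _ _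
      g.toMatrix, ih, Matrix.one_mul, ← QGate.inv_toMatrix, QGate.inv_mul]

/-- Relabelling of the qubits of a gate. -/
def QGate.map (φ : Q ↪ R) : QGate Q → QGate R
  | .single q u => .single (φ q) u
  | .cnot c t h => .cnot (φ c) (φ t) (φ.injective.ne h)
  | .toffoli c d t h h' h'' =>
    .toffoli (φ c) (φ d) (φ t) (φ.injective.ne h) (φ.injective.ne h') (φ.injective.ne h'')

theorem extend_update (φ : Q ↪ R) (y : Q → Fin 2) (z : R → Fin 2) (q : Q) (b : Fin 2) :
    Function.extend φ (Function.update y q b) z =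
      Function.update (Function.extend φ y z) (φ q) b := by
  ext r
  by_cases hr : ∃ a, φ a = r
  · obtain ⟨a, rfl⟩ := hr
    rw [φ.injective.extend_apply]
    by_cases ha : a = q
    · subst ha; simp
    · rw [Function.update_of_ne ha, Function.update_of_ne (φ.injective.ne ha),
        φ.injective.extend_apply]
  · rw [Function.extend_apply' _ _ _ hr, Function.update_of_ne, Function.extend_apply' _ _ _ hr]
    rintro rfl
    exact hr ⟨q, rfl⟩

/-- The matrix gluing the state of the qubits in the range of `φ` with the state `z` of the
others. -/
noncomputable def glueMatrix (φ : Q ↪ R) (z : R → Fin 2) : Matrix (R → Fin 2) (Q → Fin 2) ℂ :=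
  funMatrix fun y => Function.extend φ y z

theorem glueMatrix_ket (φ : Q ↪ R) (z : R → Fin 2) (y : Q → Fin 2) :
    glueMatrix φ z *ᵥ ket y = ket (Function.extend φ y z) :=
  funMatrix_mulVec_ket _ _

/-- Spectator qubits are frozen in a fixed state by `glueMatrix`, so locality of a gate becomes an
intertwining relation and no tensor factorisation of the register is needed. -/
theorem QGate.map_mul (φ : Q ↪ R) (z : R → Fin 2) (g : QGate Q) :
    (g.map φ).toMatrix * glueMatrix φ z =
      glueMatrix φ z * g.toMatrix := by
  apply ext_ket
  intro y
  rw [← mulVec_mulVec, ← mulVec_mulVec, glueMatrix_ket]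
  cases g with
  | single q u =>
    simp only [QGate.map, QGate.single_ket, mulVec_sum, mulVec_smul, glueMatrix_ket,
      extend_update, φ.injective.extend_apply]
  | cnot c t h =>
    simp only [QGate.map, QGate.cnot_ket, glueMatrix_ket,
      extend_update, φ.injective.extend_apply]
  | toffoli c d t h h' h'' =>
    simp only [QGate.map, QGate.toffoli_ket, glueMatrix_ket,
      extend_update, φ.injective.extend_apply]

/-- A circuit acts on the relabelled qubits as it does on the original ones, whatever the state of
the other qubits. -/
theorem QCircuit.map_mul (φ : Q ↪ R) (z : R → Fin 2) (c : QCircuit Q) :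
    QCircuit.toMatrix (c.map (QGate.map φ)) * glueMatrix φ z =
      glueMatrix φ z * QCircuit.toMatrix c := by
  induction c with
  | nil => simp [QCircuit.toMatrix_nil]
  | cons g c ih =>
    rw [List.map_cons, QCircuit.toMatrix_cons, Matrix.mul_assoc, QGate.map_mul,
      ← Matrix.mul_assoc, ih, QCircuit.toMatrix_cons, Matrix.mul_assoc]

theorem QCircuit.map_ket (φ : Q ↪ R) (c : QCircuit Q) {y y' : Q → Fin 2} {x x' : R → Fin 2}
    (h : QCircuit.toMatrix c *ᵥ ket y = ket y')
    (hx : ∀ q, x (φ q) = y q) (hx' : ∀ q, x' (φ q) = y' q)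
    (hne : ∀ r, r ∉ Set.range φ → x' r = x r) :
    QCircuit.toMatrix (c.map (QGate.map φ)) *ᵥ ket x = ket x' := by
  have h1 : x = Function.extend φ y x := by
    ext r
    by_cases hr : ∃ a, φ a = r
    · obtain ⟨a, rfl⟩ := hr
      rw [φ.injective.extend_apply, hx]
    · rw [Function.extend_apply' _ _ _ hr]
  have h2 : x' = Function.extend φ y' x := by
    ext r
    by_cases hr : ∃ a, φ a = r
    · obtain ⟨a, rfl⟩ := hr
      rw [φ.injective.extend_apply, hx']
    · rw [Function.extend_apply' _ _ _ hr, hne r hr]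
  have h3 := congrArg (· *ᵥ ket y) (QCircuit.map_mul φ x c)
  simp only [← mulVec_mulVec, glueMatrix_ket, h] at h3
  rw [← h1, ← h2] at h3
  exact h3

end Gates

/-! ## Implementable operators -/

section Implementable

variable {Q W : Type} [Fintype Q] [DecidableEq Q] [Fintype W] [DecidableEq W]

/-- Append work qubits in the state zero. -/
def pad (W : Type) (x : Q → Fin 2) : Q ⊕ W → Fin 2 := Sum.elim x 0

/-- The matrix appending work qubits in the state zero. -/
def padMatrix (Q W : Type) [Fintype Q] [DecidableEq Q] [Fintype W] [DecidableEq W] :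
    Matrix (Q ⊕ W → Fin 2) (Q → Fin 2) ℂ :=
  funMatrix (pad W)

theorem padMatrix_ket (y : Q → Fin 2) : padMatrix Q W *ᵥ ket y = ket (pad W y) :=
  funMatrix_mulVec_ket _ _

theorem pad_injective : Function.Injective (pad W : (Q → Fin 2) → _) := fun x y h => by
  ext q
  exact congrArg Fin.val (congrFun h (Sum.inl q))

theorem conjTranspose_padMatrix_mul : (padMatrix Q W)ᴴ * padMatrix Q W = 1 :=
  conjTranspose_funMatrix_mul pad_injective

theorem sumElim_eq_pad_iff (x y : Q → Fin 2) (z : W → Fin 2) :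
    Sum.elim x z = pad W y ↔ x = y ∧ z = 0 := by
  constructor
  · intro h
    exact ⟨funext fun q => congrFun h (Sum.inl q), funext fun q => congrFun h (Sum.inr q)⟩
  · rintro ⟨rfl, rfl⟩; rfl

/-- Turns the entrywise definition into an identity of operators that composes under multiplication.
-/
theorem QCircuit.implements_iff {w : ℕ} (c : QCircuit (Q ⊕ Fin w))
    (U : Matrix (Q → Fin 2) (Q → Fin 2) ℂ) :
    c.Implements U ↔
      QCircuit.toMatrix c * padMatrix Q (Fin w) = padMatrix Q (Fin w) * U := by
  have hl : ∀ (v : Q ⊕ Fin w → Fin 2) (y : Q → Fin 2),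
      (QCircuit.toMatrix c * padMatrix Q (Fin w)) v y =
        QCircuit.toMatrix c v (Sum.elim y 0) := by
    intro v y
    rw [← mulVec_ket (QCircuit.toMatrix c * padMatrix Q (Fin w)), ← mulVec_mulVec, padMatrix_ket,
      mulVec_ket, pad]
  have hr : ∀ (x y : Q → Fin 2) (z : Fin w → Fin 2),
      (padMatrix Q (Fin w) * U) (Sum.elim x z) y = if z = 0 then U x y else 0 := by
    intro x y z
    rw [Matrix.mul_apply]
    simp only [padMatrix, funMatrix, of_apply, sumElim_eq_pad_iff]
    by_cases hz : z = 0 <;> simp [hz]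
  constructor
  · intro h
    ext v y
    have hv : v = Sum.elim (v ∘ Sum.inl) (v ∘ Sum.inr) := (Sum.elim_comp_inl_inr v).symm
    rw [hl, hv, hr, h]
  · intro h x y z
    rw [← hl, h, hr]

/-- `U` is implemented, with work qubits, by a circuit of at most `N` gates. -/
def Implementable (U : Matrix (Q → Fin 2) (Q → Fin 2) ℂ) (N : ℕ) : Prop :=
  ∃ (w : ℕ) (c : QCircuit (Q ⊕ Fin w)), c.Implements U ∧ c.length ≤ N

/-- Relabelling of the work qubits. -/
theorem QCircuit.map_work {W' : Type} [Fintype W'] [DecidableEq W'] (φ : W ↪ W')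
    {c : QCircuit (Q ⊕ W)} {U : Matrix (Q → Fin 2) (Q → Fin 2) ℂ}
    (h : QCircuit.toMatrix c * padMatrix Q W = padMatrix Q W * U) :
    QCircuit.toMatrix (c.map (QGate.map ((Function.Embedding.refl Q).sumMap φ))) *
      padMatrix Q W' = padMatrix Q W' * U := by
  have h1 : padMatrix Q W' =
      glueMatrix ((Function.Embedding.refl Q).sumMap φ) 0 *
        padMatrix Q W := by
    rw [padMatrix, glueMatrix, padMatrix, funMatrix_mul]
    congr 1
    ext y r
    by_cases hr : ∃ a, ((Function.Embedding.refl Q).sumMap φ) a = r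
    · obtain ⟨a, rfl⟩ := hr
      rw [Function.comp_apply, (Function.Embedding.injective _).extend_apply]
      cases a <;> simp [pad]
    · rw [Function.comp_apply, Function.extend_apply' _ _ _ hr]
      cases r with
      | inl q => exact absurd ⟨Sum.inl q, rfl⟩ hr
      | inr q => simp [pad]
  rw [h1, ← Matrix.mul_assoc, QCircuit.map_mul, Matrix.mul_assoc, h, Matrix.mul_assoc]

theorem Implementable.of_circuit {c : QCircuit (Q ⊕ W)} {U : Matrix (Q → Fin 2) (Q → Fin 2) ℂ}
    (h : QCircuit.toMatrix c * padMatrix Q W = padMatrix Q W * U) :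
    Implementable U c.length :=
  ⟨Fintype.card W, c.map (QGate.map ((Function.Embedding.refl Q).sumMap
    (Fintype.equivFin W).toEmbedding)), (QCircuit.implements_iff _ _).2 (QCircuit.map_work _ h),
    by simp⟩

theorem Implementable.mono {U : Matrix (Q → Fin 2) (Q → Fin 2) ℂ} {M N : ℕ}
    (h : Implementable U M) (hMN : M ≤ N) : Implementable U N := by
  obtain ⟨w, c, h1, h2⟩ := h
  exact ⟨w, c, h1, h2.trans hMN⟩

/-- The two circuits get disjoint work registers, and each leaves the other's zeros alone. -/
theorem Implementable.mul {U V : Matrix (Q → Fin 2) (Q → Fin 2) ℂ} {M N : ℕ}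
    (hU : Implementable U M) (hV : Implementable V N) : Implementable (U * V) (M + N) := by
  obtain ⟨w, c, h1, h2⟩ := hU
  obtain ⟨w', c', h1', h2'⟩ := hV
  rw [QCircuit.implements_iff] at h1 h1'
  have k := QCircuit.map_work (Function.Embedding.inl : Fin w ↪ Fin w ⊕ Fin w') h1
  have k' := QCircuit.map_work (Function.Embedding.inr : Fin w' ↪ Fin w ⊕ Fin w') h1'
  refine (Implementable.of_circuit (c := c'.map (QGate.map ((Function.Embedding.refl Q).sumMap
    Function.Embedding.inr)) ++ c.map (QGate.map ((Function.Embedding.refl Q).sumMap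
    Function.Embedding.inl))) (U := U * V) ?_).mono ?_
  · rw [QCircuit.toMatrix_append, Matrix.mul_assoc, k', ← Matrix.mul_assoc, k, Matrix.mul_assoc]
  · simp only [List.length_append, List.length_map]; omega

theorem Implementable.gate (g : QGate Q) : Implementable g.toMatrix 1 := by
  refine Implementable.of_circuit (W := Empty) (c := [g.map Function.Embedding.inl]) ?_
  have h1 : padMatrix Q Empty =
      glueMatrix (Function.Embedding.inl : Q ↪ Q ⊕ Empty) 0 := by
    rw [padMatrix, glueMatrix]
    congr 1
    ext y r
    rcases r with q | q
    · have := (Function.Embedding.inl : Q ↪ Q ⊕ Empty).injective.extend_apply y 0 q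
      rw [Function.Embedding.inl_apply] at this
      rw [this]; rfl
    · exact q.elim
  rw [QCircuit.toMatrix_singleton, h1, QGate.map_mul]

theorem Implementable.one : Implementable (1 : Matrix (Q → Fin 2) (Q → Fin 2) ℂ) 0 :=
  Implementable.of_circuit (W := Empty) (c := []) (by simp [QCircuit.toMatrix_nil])

theorem Implementable.circuit (c : QCircuit Q) :
    Implementable (QCircuit.toMatrix c) c.length := by
  induction c with
  | nil => exact Implementable.one
  | cons g c ih => exact ih.mul (Implementable.gate g)

/-- With `P` the padding isometry and `C` the unitary of the circuit, `Uᴴ U = (P U)ᴴ (P U) = (C P)ᴴ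
(C P) = 1`. Unitarity of the block-encoding comes from here. -/
theorem QCircuit.Implements.conjTranspose_mul {w : ℕ} {c : QCircuit (Q ⊕ Fin w)}
    {U : Matrix (Q → Fin 2) (Q → Fin 2) ℂ} (h : c.Implements U) : Uᴴ * U = 1 := by
  rw [QCircuit.implements_iff] at h
  have hp := conjTranspose_padMatrix_mul (Q := Q) (W := Fin w)
  have h1 : (padMatrix Q (Fin w) * U)ᴴ * (padMatrix Q (Fin w) * U) = Uᴴ * U := by
    rw [Matrix.conjTranspose_mul, Matrix.mul_assoc, ← Matrix.mul_assoc _ _ U, hp, Matrix.one_mul]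
  rw [← h1, ← h, Matrix.conjTranspose_mul, Matrix.mul_assoc,
    ← Matrix.mul_assoc _ _ (padMatrix Q (Fin w)), QCircuit.conjTranspose_mul_toMatrix,
    Matrix.one_mul, hp]

theorem Implementable.conjTranspose {U : Matrix (Q → Fin 2) (Q → Fin 2) ℂ} {N : ℕ}
    (h : Implementable U N) : Implementable Uᴴ N := by
  obtain ⟨w, c, h1, h2⟩ := h
  -- A left inverse of a square matrix is a right inverse; this allows `U * Uᴴ` to be inserted after
  -- the padding.
  have hU := mul_eq_one_comm.1 h1.conjTranspose_mul
  refine ⟨w, QCircuit.inv c, ?_, by rwa [QCircuit.length_inv]⟩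
  rw [QCircuit.implements_iff] at h1 ⊢
  rw [QCircuit.inv_toMatrix]
  calc (QCircuit.toMatrix c)ᴴ * padMatrix Q (Fin w)
      = (QCircuit.toMatrix c)ᴴ * ((padMatrix Q (Fin w) * U) * Uᴴ) := by
        rw [Matrix.mul_assoc, hU, Matrix.mul_one]
    _ = padMatrix Q (Fin w) * Uᴴ := by
        rw [← h1, Matrix.mul_assoc, ← Matrix.mul_assoc, QCircuit.conjTranspose_mul_toMatrix,
          Matrix.one_mul]

/-- Qubits that start in the state zero and are restored to it may be used as work qubits. -/
theorem Implementable.of_pad {V : Matrix (Q ⊕ W → Fin 2) (Q ⊕ W → Fin 2) ℂ} {N : ℕ}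
    {U : Matrix (Q → Fin 2) (Q → Fin 2) ℂ} (h : Implementable V N)
    (hU : V * padMatrix Q W = padMatrix Q W * U) : Implementable U N := by
  obtain ⟨w, c, h1, h2⟩ := h
  rw [QCircuit.implements_iff] at h1
  let e : (Q ⊕ W) ⊕ Fin w ↪ Q ⊕ (W ⊕ Fin w) := (Equiv.sumAssoc Q W (Fin w)).toEmbedding
  have h3 : padMatrix Q (W ⊕ Fin w) =
      glueMatrix e 0 * (padMatrix (Q ⊕ W) (Fin w) *
        padMatrix Q W) := by
    rw [padMatrix, glueMatrix, padMatrix, padMatrix, funMatrix_mul, funMatrix_mul]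
    congr 1
    ext y r
    obtain ⟨a, rfl⟩ := (Equiv.sumAssoc Q W (Fin w)).surjective r
    have := e.injective.extend_apply (pad (Fin w) (pad W y)) 0 a
    rw [Function.comp_apply, Function.comp_apply]
    change _ = ((Function.extend e (pad (Fin w) (pad W y)) 0 (e a) : Fin 2) : ℕ)
    rw [this]
    rcases a with (a | a) | a <;> rfl
  refine (Implementable.of_circuit (c := c.map (QGate.map e)) (U := U) ?_).mono (by simpa using h2)
  rw [h3, ← Matrix.mul_assoc, QCircuit.map_mul, Matrix.mul_assoc,
    ← Matrix.mul_assoc (QCircuit.toMatrix c), h1, Matrix.mul_assoc, hU]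
  simp only [Matrix.mul_assoc]

end Implementable

/-! ## Straight-line Boolean programs -/

section Boolean

variable {Q : Type}

/-- The list of functions computed, latest first, by a straight-line Boolean program with inputs
labelled by `Q`. -/
inductive Wires : List ((Q → Fin 2) → Fin 2) → Prop
  | nil : Wires []
  | one {L} : Wires L → Wires ((fun _ => 1) :: L)
  | input {L} (q : Q) : Wires L → Wires ((fun x => x q) :: L)
  | mul {L f g} : Wires L → f ∈ L → g ∈ L → Wires ((fun x => f x * g x) :: L)
  | add {L f g} : Wires L → f ∈ L → g ∈ L → Wires ((fun x => f x + g x) :: L)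

/-- Once the functions in `S` are computed, those in `T` can be computed in `N` further steps. -/
def Computes (S : Set ((Q → Fin 2) → Fin 2)) (N : ℕ) (T : Set ((Q → Fin 2) → Fin 2)) : Prop :=
  ∀ L, Wires L → (∀ f ∈ S, f ∈ L) →
    ∃ L', Wires L' ∧ (∀ f ∈ L, f ∈ L') ∧ (∀ f ∈ T, f ∈ L') ∧ L'.length ≤ L.length + N

theorem Computes.exists_wires {N : ℕ} {T : Set ((Q → Fin 2) → Fin 2)} (h : Computes ∅ N T) :
    ∃ L, Wires L ∧ (∀ f ∈ T, f ∈ L) ∧ L.length ≤ N := by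
  obtain ⟨L, h1, -, h2, h3⟩ := h [] Wires.nil (by simp)
  exact ⟨L, h1, h2, by simpa using h3⟩

theorem Computes.mono {S S' T T' : Set ((Q → Fin 2) → Fin 2)} {N N' : ℕ} (h : Computes S N T)
    (hS : S ⊆ S') (hN : N ≤ N') (hT : T' ⊆ T) : Computes S' N' T' := by
  intro L hL hS'
  obtain ⟨L', h1, h2, h3, h4⟩ := h L hL fun f hf => hS' f (hS hf)
  exact ⟨L', h1, h2, fun f hf => h3 f (hT hf), by omega⟩

theorem Computes.of_subset {S T : Set ((Q → Fin 2) → Fin 2)} (h : T ⊆ S) : Computes S 0 T :=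
  fun L hL hS => ⟨L, hL, fun _ hf => hf, fun f hf => hS f (h hf), le_rfl⟩

/-- The second stage may use the results of the first, so shared intermediate values are paid for
only once. -/
theorem Computes.trans {S T T' : Set ((Q → Fin 2) → Fin 2)} {M N : ℕ} (h : Computes S M T)
    (h' : Computes (S ∪ T) N T') : Computes S (M + N) (T ∪ T') := by
  intro L hL hS
  obtain ⟨L₁, h1, h2, h3, h4⟩ := h L hL hS
  obtain ⟨L₂, k1, k2, k3, k4⟩ := h' L₁ h1 fun f hf => hf.elim (fun hf => h2 f (hS f hf)) (h3 f)
  exact ⟨L₂, k1, fun f hf => k2 f (h2 f hf), fun f hf => hf.elim (fun hf => k2 f (h3 f hf)) (k3 f),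
    by omega⟩

/-- Computing `T'` after `T`, and keeping only `T'`. -/
theorem Computes.then {S T T' : Set ((Q → Fin 2) → Fin 2)} {M N : ℕ} (h : Computes S M T)
    (h' : Computes (S ∪ T) N T') : Computes S (M + N) T' :=
  (h.trans h').mono subset_rfl le_rfl Set.subset_union_right

theorem Computes.biUnion {ι : Type} {S : Set ((Q → Fin 2) → Fin 2)}
    {T : ι → Set ((Q → Fin 2) → Fin 2)} {N : ℕ} (s : Finset ι)
    (h : ∀ i ∈ s, Computes S N (T i)) : Computes S (s.card * N) (⋃ i ∈ s, T i) := by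
  classical
  induction s using Finset.induction_on with
  | empty => exact (Computes.of_subset (T := ∅) (by simp)).mono subset_rfl (by simp) (by simp)
  | insert a s ha ih =>
    have h1 := ih fun i hi => h i (Finset.mem_insert_of_mem hi)
    have h2 := (h a (Finset.mem_insert_self a s)).mono
      (Set.subset_union_left (t := ⋃ i ∈ s, T i)) le_rfl subset_rfl
    refine (h1.trans h2).mono subset_rfl ?_ ?_
    · rw [Finset.card_insert_of_notMem ha]; exact le_of_eq (by ring)
    · rw [Finset.set_biUnion_insert, Set.union_comm]

theorem Computes.range {ι : Type} [Fintype ι] {S : Set ((Q → Fin 2) → Fin 2)}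
    {f : ι → (Q → Fin 2) → Fin 2} {N : ℕ} (h : ∀ i, Computes S N {f i}) :
    Computes S (Fintype.card ι * N) (Set.range f) :=
  (Computes.biUnion Finset.univ fun i _ => h i).mono subset_rfl le_rfl (by
    rintro _ ⟨i, rfl⟩
    simp)

theorem Computes.one {S : Set ((Q → Fin 2) → Fin 2)} : Computes S 1 {fun _ => 1} :=
  fun L hL _ => ⟨_, hL.one, fun _ hf => List.mem_cons_of_mem _ hf, by simp, by simp⟩

theorem Computes.input {S : Set ((Q → Fin 2) → Fin 2)} (q : Q) :
    Computes S 1 {fun x => x q} :=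
  fun L hL _ => ⟨_, hL.input q, fun _ hf => List.mem_cons_of_mem _ hf, by simp, by simp⟩

theorem Computes.mul {S : Set ((Q → Fin 2) → Fin 2)} {f g : (Q → Fin 2) → Fin 2} {M N : ℕ}
    (hf : Computes S M {f}) (hg : Computes S N {g}) :
    Computes S (M + N + 1) {fun x => f x * g x} := by
  have h : Computes (S ∪ ({f} ∪ {g})) 1 {fun x => f x * g x} := fun L hL hS =>
    ⟨_, hL.mul (hS f (by simp)) (hS g (by simp)), fun _ hf => List.mem_cons_of_mem _ hf,
      by simp, by simp⟩
  exact (hf.trans (hg.mono Set.subset_union_left le_rfl subset_rfl)).then h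

theorem Computes.add {S : Set ((Q → Fin 2) → Fin 2)} {f g : (Q → Fin 2) → Fin 2} {M N : ℕ}
    (hf : Computes S M {f}) (hg : Computes S N {g}) :
    Computes S (M + N + 1) {fun x => f x + g x} := by
  have h : Computes (S ∪ ({f} ∪ {g})) 1 {fun x => f x + g x} := fun L hL hS =>
    ⟨_, hL.add (hS f (by simp)) (hS g (by simp)), fun _ hf => List.mem_cons_of_mem _ hf,
      by simp, by simp⟩
  exact (hf.trans (hg.mono Set.subset_union_left le_rfl subset_rfl)).then h

theorem Computes.of_mem {S : Set ((Q → Fin 2) → Fin 2)} {f : (Q → Fin 2) → Fin 2} (h : f ∈ S) :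
    Computes S 0 {f} :=
  Computes.of_subset (by simpa using h)

theorem Computes.zero {S : Set ((Q → Fin 2) → Fin 2)} : Computes S 3 {fun _ => 0} :=
  Computes.one.add Computes.one

theorem Computes.prod {ι : Type} {S : Set ((Q → Fin 2) → Fin 2)}
    {f : ι → (Q → Fin 2) → Fin 2} {N : ℕ} (s : Finset ι) (h : ∀ i ∈ s, Computes S N {f i}) :
    Computes S (s.card * (N + 1) + 1) {fun x => ∏ i ∈ s, f i x} := by
  classical
  induction s using Finset.induction_on with
  | empty => simpa using Computes.one (S := S)
  | insert a s ha ih =>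
    refine ((h a (Finset.mem_insert_self a s)).mul
      (ih fun i hi => h i (Finset.mem_insert_of_mem hi))).mono subset_rfl ?_ ?_
    · rw [Finset.card_insert_of_notMem ha]; exact le_of_eq (by ring)
    · simp [Finset.prod_insert ha]

theorem Computes.sum {ι : Type} {S : Set ((Q → Fin 2) → Fin 2)}
    {f : ι → (Q → Fin 2) → Fin 2} {N : ℕ} (s : Finset ι) (h : ∀ i ∈ s, Computes S N {f i}) :
    Computes S (s.card * (N + 1) + 3) {fun x => ∑ i ∈ s, f i x} := by
  classical
  induction s using Finset.induction_on with
  | empty => simpa using Computes.zero (S := S)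
  | insert a s ha ih =>
    refine ((h a (Finset.mem_insert_self a s)).add
      (ih fun i hi => h i (Finset.mem_insert_of_mem hi))).mono subset_rfl ?_ ?_
    · rw [Finset.card_insert_of_notMem ha]; exact le_of_eq (by ring)
    · simp [Finset.sum_insert ha]

end Boolean

/-! ## Reversible circuits from Boolean programs -/

section Reversible

variable {Q : Type} [Fintype Q] [DecidableEq Q]

/-- The NOT gate. -/
noncomputable def notUnitary : Matrix.unitaryGroup (Fin 2) ℂ :=
  ⟨!![0, 1; 1, 0], by
    rw [Matrix.mem_unitaryGroup_iff]
    ext i j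
    fin_cases i <;> fin_cases j <;> simp [Matrix.mul_apply]⟩

theorem QGate.not_ket (t : Q) (y : Q → Fin 2) :
    (QGate.single t notUnitary).toMatrix *ᵥ ket y = ket (Function.update y t (y t + 1)) := by
  rw [QGate.single_ket, Fin.sum_univ_two]
  rcases Fin.exists_fin_two.1 ⟨y t, rfl⟩ with h | h <;> simp [notUnitary, h]

/-- The new value gets a fresh qubit at index `0`, the older ones moving up by one. It remains to
supply at most two gates that write `g` into this fresh zero. -/
theorem exists_circuit_cons {L : List ((Q → Fin 2) → Fin 2)} {g : (Q → Fin 2) → Fin 2}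
    (hL : ∃ c : QCircuit (Q ⊕ Fin L.length), c.length ≤ 2 * L.length ∧
      ∀ y, QCircuit.toMatrix c *ᵥ ket (pad _ y) = ket (Sum.elim y fun i => L.get i y))
    {d : QCircuit (Q ⊕ Fin (L.length + 1))} (hd : d.length ≤ 2)
    (hg : ∀ y, QCircuit.toMatrix d *ᵥ
      ket (Sum.elim y (Fin.cons 0 fun i : Fin L.length => L.get i y : Fin (L.length + 1) → Fin 2)) =
      ket (Function.update (Sum.elim y (Fin.cons 0 fun i : Fin L.length => L.get i y :
        Fin (L.length + 1) → Fin 2)) (Sum.inr 0) (g y))) :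
    ∃ c : QCircuit (Q ⊕ Fin (g :: L).length), c.length ≤ 2 * (g :: L).length ∧
      ∀ y, QCircuit.toMatrix c *ᵥ ket (pad _ y) =
        ket (Sum.elim y fun i => (g :: L).get i y) := by
  obtain ⟨c, h1, h2⟩ := hL
  refine ⟨c.map (QGate.map ((Function.Embedding.refl Q).sumMap (Fin.succEmb L.length))) ++ d,
    by simp only [List.length_append, List.length_map, List.length_cons]; omega, fun y => ?_⟩
  have h3 := QCircuit.map_ket ((Function.Embedding.refl Q).sumMap (Fin.succEmb L.length)) c
    (x := pad (Fin (L.length + 1)) y) (x' := Sum.elim y (Fin.cons 0 fun i => L.get i y)) (h2 y)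
    (by rintro (q | q) <;> simp [pad]) (by rintro (q | q) <;> simp) ?_
  · rw [QCircuit.toMatrix_append, ← mulVec_mulVec]
    refine (congrArg _ h3).trans ((hg y).trans (congrArg ket ?_))
    rw [Sum.update_elim_inr]
    congr 1
    funext i
    induction i using Fin.cases <;> rfl
  · rintro (r | r) hr
    · rfl
    · induction r using Fin.cases with
      | zero => simp [pad]
      | succ i => exact absurd ⟨Sum.inr i, rfl⟩ hr

/-- Every value keeps a qubit of its own, so nothing is overwritten. A constant is a NOT, an input a
CNOT, a product a Toffoli, a sum two CNOTs. -/
theorem Wires.exists_circuit {L : List ((Q → Fin 2) → Fin 2)} (h : Wires L) :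
    ∃ c : QCircuit (Q ⊕ Fin L.length), c.length ≤ 2 * L.length ∧
      ∀ y, QCircuit.toMatrix c *ᵥ ket (pad _ y) = ket (Sum.elim y fun i => L.get i y) := by
  induction h with
  | nil =>
    refine ⟨[], by simp, fun y => ?_⟩
    rw [QCircuit.toMatrix_nil, one_mulVec, pad]
    congr 2
    ext i
    exact i.elim0
  | @one L _ ih =>
    refine exists_circuit_cons ih (d := [QGate.single (Sum.inr 0) notUnitary]) (by simp)
      fun y => ?_
    rw [QCircuit.toMatrix_singleton, QGate.not_ket]
    simp
  | @input L q _ ih =>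
    refine exists_circuit_cons ih (d := [QGate.cnot (Sum.inl q) (Sum.inr 0) (by simp)]) (by simp)
      fun y => ?_
    rw [QCircuit.toMatrix_singleton, QGate.cnot_ket]
    simp
  | @mul L f g _ hf hg ih =>
    obtain ⟨i, rfl⟩ := List.get_of_mem hf
    obtain ⟨j, rfl⟩ := List.get_of_mem hg
    by_cases hij : i = j
    -- A Toffoli needs distinct controls; a square of a bit is the bit itself, and a CNOT copies it.
    · subst hij
      refine exists_circuit_cons ih
        (d := [QGate.cnot (Sum.inr i.succ) (Sum.inr 0) (by simp [Fin.succ_ne_zero])]) (by simp)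
        fun y => ?_
      rw [QCircuit.toMatrix_singleton, QGate.cnot_ket]
      have : ∀ a : Fin 2, a * a = a := by decide
      simp only [this]
      simp
    · refine exists_circuit_cons ih
        (d := [QGate.toffoli (Sum.inr i.succ) (Sum.inr j.succ) (Sum.inr 0) (by simpa using hij)
          (by simp [Fin.succ_ne_zero]) (by simp [Fin.succ_ne_zero])]) (by simp)
        fun y => ?_
      rw [QCircuit.toMatrix_singleton, QGate.toffoli_ket]
      simp
  | @add L f g _ hf hg ih =>
    obtain ⟨i, rfl⟩ := List.get_of_mem hf
    obtain ⟨j, rfl⟩ := List.get_of_mem hg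
    refine exists_circuit_cons ih
      (d := [QGate.cnot (Sum.inr i.succ) (Sum.inr 0) (by simp [Fin.succ_ne_zero]),
        QGate.cnot (Sum.inr j.succ) (Sum.inr 0) (by simp [Fin.succ_ne_zero])]) (by simp)
      fun y => ?_
    rw [QCircuit.toMatrix_cons, QCircuit.toMatrix_singleton, ← mulVec_mulVec, QGate.cnot_ket,
      QGate.cnot_ket]
    simp

/-- XOR of the qubits `src i` into the qubits `tgt i`. -/
def xorCircuit {ι R : Type} (src tgt : ι → R) (h : ∀ i j, src i ≠ tgt j) (l : List ι) :
    QCircuit R :=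
  l.map fun i => QGate.cnot (src i) (tgt i) (h i i)

theorem xorCircuit_ket {ι R : Type} [Fintype R] [DecidableEq R] {src tgt : ι → R}
    (h : ∀ i j, src i ≠ tgt j) (ht : Function.Injective tgt) {l : List ι} (hl : l.Nodup)
    {z z' : R → Fin 2} (h1 : ∀ i ∈ l, z' (tgt i) = z (tgt i) + z (src i))
    (h2 : ∀ r, (∀ i ∈ l, r ≠ tgt i) → z' r = z r) :
    QCircuit.toMatrix (xorCircuit src tgt h l) *ᵥ ket z = ket z' := by
  induction l generalizing z with
  | nil =>
    rw [xorCircuit, List.map_nil, QCircuit.toMatrix_nil, one_mulVec]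
    congr 1
    ext r
    rw [h2 r (by simp)]
  | cons i l ih =>
    rw [xorCircuit, List.map_cons, QCircuit.toMatrix_cons, ← mulVec_mulVec, QGate.cnot_ket]
    obtain ⟨hi, hl⟩ := List.nodup_cons.1 hl
    refine ih hl (fun j hj => ?_) fun r hr => ?_
    · have hji : j ≠ i := by rintro rfl; exact hi hj
      rw [h1 j (List.mem_cons_of_mem _ hj), Function.update_of_ne (ht.ne hji),
        Function.update_of_ne (h j i)]
    · by_cases hri : r = tgt i
      · subst hri
        rw [h1 i List.mem_cons_self, Function.update_self]
      · rw [Function.update_of_ne hri, h2]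
        simp only [List.mem_cons]
        rintro j (rfl | hj)
        · exact hri
        · exact hr j hj

/-- The oracle adding the bits `G i x` to the qubits `i`. -/
def xorOracle {ι : Type} (G : ι → (Q → Fin 2) → Fin 2) (v : Q ⊕ ι → Fin 2) : Q ⊕ ι → Fin 2 :=
  Sum.elim (v ∘ Sum.inl) fun i => v (Sum.inr i) + G i (v ∘ Sum.inl)

/-- A Boolean program gives an oracle: compute, copy, uncompute. -/
theorem implementable_xorOracle {ι : Type} [Fintype ι] [DecidableEq ι]
    {G : ι → (Q → Fin 2) → Fin 2} {N : ℕ} (h : Computes ∅ N (Set.range G)) :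
    Implementable (funMatrix (xorOracle G)) (4 * N + Fintype.card ι) := by
  obtain ⟨L, hL, hG, hN⟩ := h.exists_wires
  obtain ⟨c, hc1, hc2⟩ := hL.exists_circuit
  have hidx : ∀ i, ∃ k, L.get k = G i := fun i => List.get_of_mem (hG _ ⟨i, rfl⟩)
  choose k hk using hidx
  let φ : Q ⊕ Fin L.length ↪ (Q ⊕ ι) ⊕ Fin L.length :=
    Function.Embedding.inl.sumMap (Function.Embedding.refl _)
  let d : QCircuit ((Q ⊕ ι) ⊕ Fin L.length) := c.map (QGate.map φ)
  let e := xorCircuit (R := (Q ⊕ ι) ⊕ Fin L.length) (fun i => Sum.inr (k i))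
    (fun i : ι => Sum.inl (Sum.inr i)) (by simp) Finset.univ.toList
  have hd : ∀ v : Q ⊕ ι → Fin 2, QCircuit.toMatrix d *ᵥ ket (pad _ v) =
      ket (Sum.elim v fun i => L.get i (v ∘ Sum.inl)) := by
    intro v
    refine QCircuit.map_ket φ c (hc2 (v ∘ Sum.inl)) ?_ ?_ ?_
    · rintro (q | q) <;> rfl
    · rintro (q | q) <;> rfl
    · rintro (q | q) hq
      · rfl
      · exact absurd ⟨Sum.inr q, rfl⟩ hq
  -- The program costs at most `2 * N` gates and is run forwards and backwards; copying takes one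
  -- CNOT per output.
  refine (Implementable.of_circuit (c := d ++ e ++ QCircuit.inv d)
    (U := funMatrix (xorOracle G)) ?_).mono ?_
  · apply ext_ket
    intro v
    rw [← mulVec_mulVec, ← mulVec_mulVec, padMatrix_ket, funMatrix_mulVec_ket, padMatrix_ket,
      QCircuit.toMatrix_append, QCircuit.toMatrix_append, ← mulVec_mulVec, ← mulVec_mulVec, hd,
      QCircuit.inv_toMatrix, xorCircuit_ket (z' := Sum.elim (xorOracle G v)
        fun i => L.get i (v ∘ Sum.inl))]
    -- Copying leaves the inputs untouched, so `d` run on the new state from clean work qubits would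
    -- produce the same intermediate values; hence its inverse clears them.
    · exact mulVec_ket_of_unitary (QCircuit.conjTranspose_mul_toMatrix d) (hd (xorOracle G v))
    · intro i j hij; simpa using hij
    · exact Finset.nodup_toList _
    · intro i _
      simp only [Sum.elim_inl, Sum.elim_inr, xorOracle, hk]
    · rintro ((r | r) | r) hr
      · rfl
      · exact absurd rfl (hr r (by simp))
      · rfl
  · have he : List.length e = Fintype.card ι := by
      simp [e, xorCircuit]
    have hd' : List.length d = List.length c := by simp [d]
    rw [List.length_append, List.length_append, QCircuit.length_inv, he, hd']
    omega

/-- Flipping a qubit `t` depending on the value of a function that does not depend on `t`. -/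
theorem implementable_update {g : (Q → Fin 2) → Fin 2} {N : ℕ} (h : Computes ∅ N {g}) (t : Q)
    (ht : ∀ x b, g (Function.update x t b) = g x) :
    Implementable (funMatrix fun x => Function.update x t (x t + g x)) (8 * N + 3) := by
  have h1 : Implementable (funMatrix (xorOracle fun _ : Unit => g)) (4 * N + 1) :=
    implementable_xorOracle (by rwa [Set.range_const])
  have h2 := Implementable.gate (QGate.cnot (Sum.inr () : Q ⊕ Unit) (Sum.inl t) (by simp))
  -- Write `g x` on a work qubit, add it to `t`, and write it again: the value has not changed with
  -- `t`, so it cancels.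
  refine Implementable.of_pad (W := Unit) ((h1.mul (h2.mul h1)).mono (by omega)) ?_
  apply ext_ket
  intro v
  simp only [← mulVec_mulVec, padMatrix_ket, funMatrix_mulVec_ket, QGate.cnot_ket]
  congr 1
  have e1 : xorOracle (fun _ : Unit => g) (pad Unit v) = Sum.elim v fun _ => g v := by
    ext (r | r) <;> simp [xorOracle, pad, Function.comp_def]
  rw [e1]
  have e2 : Function.update (Sum.elim v fun _ : Unit => g v) (Sum.inl t)
      (Sum.elim v (fun _ : Unit => g v) (Sum.inl t) + Sum.elim v (fun _ : Unit => g v) (Sum.inr ()))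
      = Sum.elim (Function.update v t (v t + g v)) fun _ => g v := by
    rw [Sum.update_elim_inl]; rfl
  rw [e2]
  have e3 : ∀ a : Fin 2, a + a = 0 := by decide
  funext r
  rcases r with r | r
  · rfl
  · exact (congrArg _ (ht v _)).trans (e3 _)

/-- A permutation of the basis states is implementable if it and its inverse are computable. -/
theorem implementable_perm {f g : (Q → Fin 2) → Q → Fin 2} (hfg : ∀ x, g (f x) = x) {M N : ℕ}
    (hf : Computes ∅ M (Set.range fun q x => f x q))
    (hg : Computes ∅ N (Set.range fun q x => g x q)) :
    Implementable (funMatrix f) (4 * M + 4 * N + 5 * Fintype.card Q) := by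
  have h1 := implementable_xorOracle hf
  have h2 := implementable_xorOracle hg
  let a := xorCircuit (R := Q ⊕ Q) Sum.inl Sum.inr (by simp) Finset.univ.toList
  let b := xorCircuit (R := Q ⊕ Q) Sum.inr Sum.inl (by simp) Finset.univ.toList
  have ha : ∀ x y : Q → Fin 2,
      QCircuit.toMatrix a *ᵥ ket (Sum.elim x y) = ket (Sum.elim x (y + x)) := fun x y => by
    refine xorCircuit_ket _ Sum.inr_injective (Finset.nodup_toList _) (by simp) ?_
    rintro (r | r) hr
    · rfl
    · exact absurd rfl (hr r (by simp))
  have hb : ∀ x y : Q → Fin 2,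
      QCircuit.toMatrix b *ᵥ ket (Sum.elim x y) = ket (Sum.elim (x + y) y) := fun x y => by
    refine xorCircuit_ket _ Sum.inl_injective (Finset.nodup_toList _) (by simp) ?_
    rintro (r | r) hr
    · exact absurd rfl (hr r (by simp))
    · rfl
  have la : List.length a = Fintype.card Q := by simp [a, xorCircuit]
  have lb : List.length b = Fintype.card Q := by simp [b, xorCircuit]
  -- Three rounds of CNOTs swap the registers: `|x, 0⟩ ↦ |x, f x⟩ ↦ |f x, x⟩`, and then the oracle
  -- of `g` erases `x = g (f x)`.
  have h3 := (Implementable.circuit b).mul ((Implementable.circuit a).mul (Implementable.circuit b))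
  refine Implementable.of_pad (W := Q) ((h2.mul (h3.mul h1)).mono ?_) ?_
  · rw [la, lb]; omega
  apply ext_ket
  intro v
  simp only [← mulVec_mulVec, padMatrix_ket, funMatrix_mulVec_ket]
  have e1 : xorOracle (fun q x => f x q) (pad Q v) = Sum.elim v (f v) := by
    ext (r | r) <;> simp [xorOracle, pad, Function.comp_def]
  rw [e1, hb, ha, hb]
  have e3 : ∀ a : Fin 2, a + a = 0 := by decide
  have e4 : v + f v + (f v + (v + f v)) = f v := by
    funext r
    simp only [Pi.add_apply]
    generalize v r = a, f v r = b
    revert a b; decide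
  have e5 : f v + (v + f v) = v := by
    funext r
    simp only [Pi.add_apply]
    generalize v r = a, f v r = b
    revert a b; decide
  rw [e4, e5, funMatrix_mulVec_ket]
  refine congrArg (ket (X := Q ⊕ Q → Fin 2)) ?_
  funext r
  rcases r with r | r
  · rfl
  · exact (congrArg (v r + ·) (congrFun (hfg v) r)).trans (e3 _)

end Reversible

/-! ## Costs of some Boolean functions -/

section Costs

variable {Q : Type}

theorem Computes.const {S : Set ((Q → Fin 2) → Fin 2)} (b : Fin 2) :
    Computes S 3 {fun _ => b} := by
  rcases Fin.exists_fin_two.1 ⟨b, rfl⟩ with h | h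
  · rw [h]; exact Computes.zero
  · rw [h]; exact Computes.one.mono subset_rfl (by norm_num) subset_rfl

/-- The indicator function of the bit string `s` on the qubits `sel`. -/
def indicator {k : ℕ} (sel : Fin k → Q) (s : Fin k → Fin 2) (x : Q → Fin 2) : Fin 2 :=
  ∏ l, (x (sel l) + (s l + 1))

theorem indicator_eq {k : ℕ} (sel : Fin k → Q) (s : Fin k → Fin 2) (x : Q → Fin 2) :
    indicator sel s x = if s = x ∘ sel then 1 else 0 := by
  have h : ∀ a b : Fin 2, a + (b + 1) = if b = a then 1 else 0 := by decide
  rw [indicator]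
  split_ifs with hs
  · subst hs
    exact Finset.prod_eq_one fun l _ => by simp [h]
  · obtain ⟨l, hl⟩ := Function.ne_iff.1 hs
    rw [← Finset.mul_prod_erase Finset.univ _ (Finset.mem_univ l), h, if_neg (by exact hl)]
    exact Fin.zero_mul _

theorem computes_indicator_singleton {S : Set ((Q → Fin 2) → Fin 2)} {k : ℕ} (sel : Fin k → Q)
    (s : Fin k → Fin 2) : Computes S (6 * k + 1) {indicator sel s} := by
  have := Computes.prod (S := S) (f := fun l (x : Q → Fin 2) => x (sel l) + (s l + 1)) (N := 5)
    Finset.univ fun l _ => (Computes.input (sel l)).add (Computes.const (s l + 1))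
  exact this.mono subset_rfl (by simp; omega) subset_rfl

theorem computes_indicator {k : ℕ} (sel : Fin k → Q) :
    Computes ∅ (2 ^ k * (6 * k + 1)) (Set.range (indicator sel)) :=
  (Computes.range (computes_indicator_singleton sel)).mono subset_rfl (by simp) subset_rfl

/-- Selecting one of `2 ^ k` functions. -/
theorem computes_select {k : ℕ} {sel : Fin k → Q} {S : Set ((Q → Fin 2) → Fin 2)}
    (hS : Set.range (indicator sel) ⊆ S) {t : (Fin k → Fin 2) → (Q → Fin 2) → Fin 2} {K : ℕ}
    (ht : ∀ s, Computes S K {t s}) :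
    Computes S (2 ^ k * (K + 2) + 3) {fun x => t (x ∘ sel) x} := by
  -- Exactly one indicator is `1`, so the sum over `Fin 2` reduces to the selected term.
  have h := Computes.sum (f := fun s x => indicator sel s x * t s x) Finset.univ
    fun s _ => (Computes.of_mem (hS ⟨s, rfl⟩)).mul (ht s)
  refine h.mono subset_rfl ?_ ?_
  · rw [Finset.card_univ, Fintype.card_fun, Fintype.card_fin, Fintype.card_fin]
    exact le_of_eq (by ring)
  · simp [indicator_eq]

/-- The carry bits of a ripple-carry adder. -/
def carry (a b : ℕ → Fin 2) : ℕ → Fin 2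
  | 0 => 0
  | l + 1 => a l * b l + (a l + b l) * carry a b l

/-- Induction with the full-adder identity: three bits sum to their XOR plus twice their majority.
-/
theorem sum_add_carry (a b : ℕ → Fin 2) (n : ℕ) :
    (∑ l ∈ Finset.range n, (a l + b l + carry a b l : Fin 2).val * 2 ^ l) +
      (carry a b n).val * 2 ^ n =
      ∑ l ∈ Finset.range n, (a l).val * 2 ^ l + ∑ l ∈ Finset.range n, (b l).val * 2 ^ l := by
  induction n with
  | zero => simp [carry]
  | succ n ih =>
    have h : ∀ u v w : Fin 2, (u + v + w).val + (u * v + (u + v) * w).val * 2 =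
        u.val + v.val + w.val := by decide
    have h1 := congrArg (· * 2 ^ n) (h (a n) (b n) (carry a b n))
    simp only [Finset.sum_range_succ, carry] at h1 ⊢
    rw [pow_succ]
    linarith

/-- All carries are computed first, `4 * K + 4` steps each from the preceding one; each sum bit then
takes `2 * K + 2` steps. -/
theorem computes_adder {a b : ℕ → (Q → Fin 2) → Fin 2} {n K : ℕ}
    {S : Set ((Q → Fin 2) → Fin 2)} (ha : ∀ l < n, Computes S K {a l})
    (hb : ∀ l < n, Computes S K {b l}) :
    Computes S (3 + n * (6 * K + 6)) (⋃ l ∈ Finset.range n,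
      {fun x => a l x + b l x + carry (fun i => a i x) (fun i => b i x) l}) := by
  have hc : ∀ m ≤ n, Computes S (3 + m * (4 * K + 4)) (⋃ l ∈ Finset.range (m + 1),
      {fun x => carry (fun i => a i x) (fun i => b i x) l}) := by
    intro m
    induction m with
    | zero => intro _; simpa [carry] using Computes.zero (S := S)
    | succ m ih =>
      intro hm
      have h1 := ih (by omega)
      have hab := ha m (by omega)
      have hbb := hb m (by omega)
      set T := ⋃ l ∈ Finset.range (m + 1),
        {fun x => carry (fun i => a i x) (fun i => b i x) l} with hT
      have hab' := hab.mono (Set.subset_union_left (t := T)) le_rfl subset_rfl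
      have hbb' := hbb.mono (Set.subset_union_left (t := T)) le_rfl subset_rfl
      have hcc : Computes (S ∪ T) 0 {fun x => carry (fun i => a i x) (fun i => b i x) m} :=
        Computes.of_mem (Or.inr (by
          rw [hT]; exact Set.mem_biUnion (x := m) (by simp) rfl))
      refine (h1.trans ((hab'.mul hbb').add ((hab'.add hbb').mul hcc))).mono subset_rfl ?_ ?_
      · exact le_of_eq (by ring)
      · rw [Finset.range_add_one, Finset.set_biUnion_insert, Set.union_comm]
        rfl
  set T := ⋃ l ∈ Finset.range (n + 1),
    {fun x => carry (fun i => a i x) (fun i => b i x) l} with hT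
  have hs : ∀ l ∈ Finset.range n, Computes (S ∪ T) (2 * K + 2)
      {fun x => a l x + b l x + carry (fun i => a i x) (fun i => b i x) l} := by
    intro l hl
    have hl' := Finset.mem_range.1 hl
    have hcc : Computes (S ∪ T) 0 {fun x => carry (fun i => a i x) (fun i => b i x) l} :=
      Computes.of_mem (Or.inr (by
        rw [hT]; exact Set.mem_biUnion (x := l) (by simp; omega) rfl))
    exact ((((ha l hl').mono (Set.subset_union_left (t := T)) le_rfl subset_rfl).add
      ((hb l hl').mono Set.subset_union_left le_rfl subset_rfl)).add hcc).mono subset_rfl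
      (by omega) subset_rfl
  refine ((hc n le_rfl).then (Computes.biUnion (Finset.range n) hs)).mono subset_rfl ?_ subset_rfl
  rw [Finset.card_range]
  exact le_of_eq (by ring)

/-- The indicator functions of the residue classes modulo `p` of the number with bits `a`, of
which the `n` lowest ones are taken into account. -/
def residue (p : ℕ) (a : ℕ → (Q → Fin 2) → Fin 2) (n : ℕ) (r : ZMod p) (x : Q → Fin 2) : Fin 2 :=
  if ∑ l ∈ Finset.range n, ((a l x).val : ZMod p) * 2 ^ l = r then 1 else 0

/-- The new bit chooses between the old entries at `r` and at `r - 2 ^ n`; in characteristic two `u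
+ a * (u + v)` is that choice. -/
theorem residue_succ (p : ℕ) (a : ℕ → (Q → Fin 2) → Fin 2) (n : ℕ) (r : ZMod p)
    (x : Q → Fin 2) : residue p a (n + 1) r x =
      residue p a n r x + a n x * (residue p a n r x + residue p a n (r - 2 ^ n) x) := by
  simp only [residue, Finset.sum_range_succ, eq_sub_iff_add_eq]
  have h : ∀ u v : Fin 2, u + (u + v) = v := by decide
  rcases Fin.exists_fin_two.1 ⟨a n x, rfl⟩ with h' | h' <;> simp [h', h]

/-- Dynamic programming over the bits: the whole table of `p` indicators is updated at each bit, `K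
+ 3` steps per entry, so no division is carried out. -/
theorem computes_residue {p : ℕ} [NeZero p] {a : ℕ → (Q → Fin 2) → Fin 2} {n K : ℕ}
    {S : Set ((Q → Fin 2) → Fin 2)} (ha : ∀ l < n, Computes S K {a l}) :
    Computes S (p * 3 + n * (p * (K + 3))) (Set.range (residue p a n)) := by
  have h : ∀ m ≤ n, Computes S (p * 3 + m * (p * (K + 3))) (Set.range (residue p a m)) := by
    intro m
    induction m with
    | zero =>
      intro _
      have h1 : ∀ r : ZMod p, Computes S 3 {residue p a 0 r} := fun r => by
        -- With no bits read the indicator is constant, so its value may be taken at any point.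
        have := Computes.const (S := S) (residue p a 0 r 0)
        refine this.mono subset_rfl le_rfl ?_
        rw [Set.singleton_subset_singleton]
        funext x
        rfl
      simpa using Computes.range h1
    | succ m ih =>
      intro hm
      have h1 : ∀ r : ZMod p, Computes (S ∪ Set.range (residue p a m)) (K + 3)
          {residue p a (m + 1) r} := fun r => by
        have h2 : ∀ r, Computes (S ∪ Set.range (residue p a m)) 0 {residue p a m r} :=
          fun r => Computes.of_mem (Or.inr ⟨r, rfl⟩)
        have h3 := (h2 r).add (((ha m (by omega)).mono Set.subset_union_left le_rfl
          subset_rfl).mul ((h2 r).add (h2 (r - 2 ^ m))))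
        refine h3.mono subset_rfl (by omega) ?_
        rw [Set.singleton_subset_singleton]
        funext x
        exact residue_succ p a m r x
      refine ((ih (by omega)).then (Computes.range h1)).mono subset_rfl ?_ subset_rfl
      rw [ZMod.card]
      exact le_of_eq (by ring)
  exact h n le_rfl

end Costs

/-! ## Numbers in binary -/

section Binary

theorem finFunctionFinEquiv_val {n : ℕ} (x : Fin n → Fin 2) (a : ℕ → Fin 2)
    (h : ∀ l : Fin n, a l = x l) :
    (finFunctionFinEquiv x : ℕ) = ∑ l ∈ Finset.range n, (a l).val * 2 ^ l := by
  rw [finFunctionFinEquiv_apply, Finset.sum_range]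
  exact Finset.sum_congr rfl fun l _ => by rw [h]

/-- Dropping the last carry is reduction modulo `2 ^ n`, which is addition in `Fin (2 ^ n)`. -/
theorem finFunctionFinEquiv_adder {n : ℕ} {x y z : Fin n → Fin 2} {a b : ℕ → Fin 2}
    (hx : ∀ l : Fin n, a l = x l) (hy : ∀ l : Fin n, b l = y l)
    (hz : ∀ l : Fin n, a l + b l + carry a b l = z l) :
    finFunctionFinEquiv z = finFunctionFinEquiv x + finFunctionFinEquiv y := by
  apply Fin.ext
  have h1 := sum_add_carry a b n
  rw [← finFunctionFinEquiv_val x a hx, ← finFunctionFinEquiv_val y b hy,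
    ← finFunctionFinEquiv_val z (fun l => a l + b l + carry a b l) hz] at h1
  rw [Fin.val_add, ← h1, Nat.add_mul_mod_self_right, Nat.mod_eq_of_lt (Fin.is_lt _)]

theorem finFunctionFinEquiv_eq_zero_iff {n : ℕ} (x : Fin n → Fin 2) :
    (finFunctionFinEquiv x : ℕ) = 0 ↔ ∀ l, x l = 0 := by
  rw [finFunctionFinEquiv_apply, Finset.sum_eq_zero_iff]
  refine ⟨fun h l => Fin.ext ?_, fun h l _ => by rw [h l]; simp⟩
  exact (Nat.mul_eq_zero.1 (h l (Finset.mem_univ l))).resolve_right (by positivity)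

theorem finFunctionFinEquiv_eq_last_iff {n : ℕ} (x : Fin n → Fin 2) :
    (finFunctionFinEquiv x : ℕ) + 1 = 2 ^ n ↔ ∀ l, x l = 1 := by
  have h1 : (finFunctionFinEquiv (fun _ : Fin n => (1 : Fin 2)) : ℕ) + 1 = 2 ^ n := by
    rw [finFunctionFinEquiv_val _ (fun _ => 1) fun _ => rfl]
    have := Nat.geomSum_eq le_rfl n
    have h2 := Nat.one_le_two_pow (n := n)
    simp only [Fin.val_one, one_mul]
    omega
  rw [show (finFunctionFinEquiv x : ℕ) + 1 = 2 ^ n ↔ (finFunctionFinEquiv x : ℕ) =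
    (finFunctionFinEquiv (fun _ : Fin n => (1 : Fin 2)) : ℕ) by omega, ← Fin.ext_iff, finFunctionFinEquiv.injective.eq_iff,
    funext_iff]

/-- The nodes with local number `k` in some element of the Lagrange mesh. -/
theorem exists_element_iff {p numel i k N : ℕ} (hp : 1 ≤ p) (hN : N = numel * p + 1)
    (hi : i < N) (hk : k ≤ p) :
    (∃ e < numel, i = p * e + k) ↔
      (i : ZMod p) = k ∧ (k = 0 → i + 1 ≠ N) ∧ (k = p → i ≠ 0) := by
  rw [ZMod.natCast_eq_natCast_iff]
  constructor
  · rintro ⟨e, he, rfl⟩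
    have := Nat.mul_le_mul_left p (Nat.succ_le_of_lt he)
    refine ⟨by simp [Nat.ModEq], fun h => ?_, fun h => by omega⟩
    rw [mul_comm numel, Nat.mul_succ] at *
    omega
  · rintro ⟨h1, h2, h3⟩
    by_cases hki : k ≤ i
    · obtain ⟨e, he⟩ := (Nat.modEq_iff_dvd' hki).1 h1.symm
      refine ⟨e, ?_, by omega⟩
      -- Since `i ≤ numel * p`, an element index that is too large forces `k = 0` and `i` the last
      -- node.
      by_contra! hle
      have := Nat.mul_le_mul_left p hle
      rw [mul_comm numel] at hN
      omega
    -- Here `0 < k - i ≤ p` is a multiple of `p`, which leaves only `k = p`, `i = 0`.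
    · obtain ⟨e, he⟩ := (Nat.modEq_iff_dvd' (by omega : i ≤ k)).1 h1
      exfalso
      rcases Nat.eq_zero_or_pos e with rfl | he0
      · omega
      · have := Nat.mul_le_mul_left p he0
        omega

end Binary

/-! ## State preparation -/

section Preparation

variable {Q : Type} [Fintype Q] [DecidableEq Q]

/-- Serves to follow a nonzero amplitude back through a product of operators. -/
theorem exists_ne_zero_of_mul {X Y Z : Type} [Fintype Y] {M : Matrix X Y ℂ} {N : Matrix Y Z ℂ}
    {x : X} {z : Z} (h : (M * N) x z ≠ 0) : ∃ y, M x y ≠ 0 ∧ N y z ≠ 0 := by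
  rw [Matrix.mul_apply] at h
  obtain ⟨y, -, hy⟩ := Finset.exists_ne_zero_of_sum_ne_zero h
  exact ⟨y, left_ne_zero_of_mul hy, right_ne_zero_of_mul hy⟩

theorem eq_of_ne_zero {X Y : Type} [Fintype X] [DecidableEq X] [Fintype Y] [DecidableEq Y]
    {M : Matrix Y X ℂ} {x : X} {y z : Y} (hM : M *ᵥ ket x = ket z) (h : M y x ≠ 0) : y = z := by
  rw [← mulVec_ket M, hM, ket_apply] at h
  by_contra hne
  exact h (if_neg hne)

/-- The operator changes only the qubits in `T`. -/
def FixesOff (T : Set Q) (M : Matrix (Q → Fin 2) (Q → Fin 2) ℂ) : Prop :=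
  ∀ x y, M x y ≠ 0 → ∀ q, q ∉ T → x q = y q

theorem FixesOff.mul {T : Set Q} {M N : Matrix (Q → Fin 2) (Q → Fin 2) ℂ}
    (hM : FixesOff T M) (hN : FixesOff T N) : FixesOff T (M * N) := by
  intro x y h q hq
  obtain ⟨z, h1, h2⟩ := exists_ne_zero_of_mul h
  exact (hM x z h1 q hq).trans (hN z y h2 q hq)

theorem fixesOff_single (q : Q) (u : Matrix.unitaryGroup (Fin 2) ℂ) :
    FixesOff {q} (QGate.single q u).toMatrix := by
  intro x y h r hr
  rw [QGate.toMatrix, of_apply] at h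
  split_ifs at h with hx
  · rw [hx, Function.update_of_ne hr]
  · exact absurd rfl h

theorem fixesOff_cnot {c t : Q} (hct : c ≠ t) :
    FixesOff {t} (QGate.cnot c t hct).toMatrix := by
  intro x y h r hr
  rw [eq_of_ne_zero (QGate.cnot_ket c t hct y) h, Function.update_of_ne hr]

/-- A controlled reflection. -/
theorem exists_controlled_reflection {c t : Q} (hct : c ≠ t) {a b : ℝ} (hab : a ^ 2 + b ^ 2 = 1) :
    ∃ M : Matrix (Q → Fin 2) (Q → Fin 2) ℂ, Implementable M 3 ∧ FixesOff {t} M ∧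
      (∀ y, y c = 0 → M *ᵥ ket y = ket y) ∧
      ∀ y, y c = 1 → y t = 0 →
        M *ᵥ ket y = (a : ℂ) • ket y + (b : ℂ) • ket (Function.update y t 1) := by
  obtain ⟨r, s, h1, h2, h3⟩ : ∃ r s : ℝ, r ^ 2 + s ^ 2 = 1 ∧ -2 * s * r = a ∧
      r ^ 2 - s ^ 2 = b := by
    -- Half-angle formulas: `r` and `s` are the cosine and sine of half the argument of `b - a i`.
    set z : ℂ := ⟨b, -a⟩ with hz
    have hz1 : ‖z‖ = 1 := by
      rw [Complex.norm_def, Complex.normSq_mk, show b * b + -a * -a = 1 by linarith, Real.sqrt_one]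
    have hz0 : z ≠ 0 := by
      rw [← norm_ne_zero_iff, hz1]; exact one_ne_zero
    have hc : Real.cos z.arg = b := by rw [Complex.cos_arg hz0, hz1, div_one]
    have hs : Real.sin z.arg = -a := by rw [Complex.sin_arg, hz1, div_one]
    have e : z.arg = 2 * (z.arg / 2) := by ring
    refine ⟨Real.cos (z.arg / 2), Real.sin (z.arg / 2), Real.cos_sq_add_sin_sq _, ?_, ?_⟩
    · rw [e, Real.sin_two_mul] at hs
      linarith
    · rw [e, Real.cos_two_mul'] at hc
      exact hc
  have h1' : (r : ℂ) * r + s * s = 1 := by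
    have := congrArg (fun x : ℝ => (x : ℂ)) h1
    push_cast at this
    linear_combination this
  -- Conjugating NOT by this rotation gives a reflection with first column `(a, b)`. Only the NOT
  -- has to be controlled, because the rotations cancel when it is absent.
  let A : Matrix.unitaryGroup (Fin 2) ℂ := ⟨!![(r : ℂ), -s; s, r], by
    rw [Matrix.mem_unitaryGroup_iff]
    ext i j
    fin_cases i <;> fin_cases j <;> simp [Matrix.mul_apply, Fin.sum_univ_two, star_apply]
    · linear_combination h1'
    · ring
    · ring
    · linear_combination h1'⟩
  have hA : A.1 = !![(r : ℂ), -s; s, r] := rfl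
  have hA' : (A⁻¹).1 = !![(r : ℂ), s; -s, r] := by
    change star A.1 = _
    rw [hA]
    ext i j
    fin_cases i <;> fin_cases j <;> simp [star_apply]
  have hk : ∀ y : Q → Fin 2, ((QGate.single t A).toMatrix * ((QGate.cnot c t hct).toMatrix *
      (QGate.single t A⁻¹).toMatrix)) *ᵥ ket y =
        ∑ b, (A⁻¹).1 b (y t) • ∑ b', A.1 b' (b + y c) • ket (Function.update y t b') := by
    intro y
    rw [← mulVec_mulVec, ← mulVec_mulVec]
    simp only [QGate.single_ket, mulVec_sum, mulVec_smul, QGate.cnot_ket, Function.update_idem,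
      Function.update_self, Function.update_of_ne hct]
  refine ⟨_, (Implementable.gate (QGate.single t A)).mul ((Implementable.gate
    (QGate.cnot c t hct)).mul (Implementable.gate (QGate.single t A⁻¹))),
    (fixesOff_single _ _).mul ((fixesOff_cnot _).mul (fixesOff_single _ _)), ?_, ?_⟩
  · intro y hy
    rw [hk, hy, hA, hA']
    simp only [Fin.sum_univ_two, add_zero]
    rcases Fin.exists_fin_two.1 ⟨y t, rfl⟩ with h | h
    · have e : Function.update y t 0 = y := by rw [← h, Function.update_eq_self]
      rw [h, e]
      ext x
      simp
      linear_combination (ket y x) * h1'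
    · have e : Function.update y t 1 = y := by rw [← h, Function.update_eq_self]
      rw [h, e]
      ext x
      simp
      linear_combination (ket y x) * h1'
  · intro y hy ht
    have e : Function.update y t 0 = y := by rw [← ht, Function.update_eq_self]
    rw [hk, hy, ht, hA, hA', ← h2, ← h3]
    have h11 : (1 : Fin 2) + 1 = 0 := rfl
    simp only [Fin.sum_univ_two, zero_add, e, h11]
    ext x
    simp
    ring

/-- If no amplitude leaves the clean subspace, the operator restricts to it and the restriction is
its compression. -/
theorem mul_padMatrix_eq {W : Type} [Fintype W] [DecidableEq W]
    {V : Matrix (Q ⊕ W → Fin 2) (Q ⊕ W → Fin 2) ℂ}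
    (hV : ∀ v y, V v (pad W y) ≠ 0 → ∀ w, v (Sum.inr w) = 0) :
    V * padMatrix Q W = padMatrix Q W * V.submatrix (pad W) (pad W) := by
  ext v y
  rw [← mulVec_ket (V * padMatrix Q W), ← mulVec_mulVec, padMatrix_ket, mulVec_ket,
    Matrix.mul_apply]
  obtain ⟨x, z, rfl⟩ : ∃ x z, v = Sum.elim x z := ⟨_, _, (Sum.elim_comp_inl_inr v).symm⟩
  simp only [padMatrix, funMatrix, of_apply, sumElim_eq_pad_iff, submatrix_apply]
  by_cases hz : z = 0
  · subst hz; simp [pad]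
  · simp only [hz, and_false, if_false, zero_mul, Finset.sum_const_zero]
    by_contra h
    exact hz (funext fun w => hV _ _ h w)

/-- Separates the weight of a branch from its normalised content. A branch of weight zero may take
any unit vector, which needs a nonempty index type. -/
theorem exists_smul_unit {ι : Type} [Fintype ι] [Nonempty ι] (u : ι → ℂ) :
    ∃ (a : ℝ) (w : ι → ℂ), a ^ 2 = ∑ i, ‖u i‖ ^ 2 ∧ ∑ i, ‖w i‖ ^ 2 = 1 ∧ ∀ i, u i = a * w i := by
  classical
  have h0 : 0 ≤ ∑ i, ‖u i‖ ^ 2 := Finset.sum_nonneg fun i _ => by positivity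
  by_cases h : ∑ i, ‖u i‖ ^ 2 = 0
  · obtain ⟨i₀⟩ := ‹Nonempty ι›
    refine ⟨0, Pi.single i₀ 1, by rw [h]; norm_num, ?_, fun i => ?_⟩
    · rw [Finset.sum_eq_single i₀] <;> simp +contextual
    · have := (Finset.sum_eq_zero_iff_of_nonneg fun i _ => by positivity).1 h i
        (Finset.mem_univ i)
      simpa using this
  · have hs := Real.sq_sqrt h0
    have hs0 : Real.sqrt (∑ i, ‖u i‖ ^ 2) ≠ 0 := by
      intro h'; rw [h'] at hs; apply h; rw [← hs]; norm_num
    refine ⟨Real.sqrt (∑ i, ‖u i‖ ^ 2), fun i => u i / (Real.sqrt (∑ i, ‖u i‖ ^ 2) : ℝ), hs, ?_,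
      fun i => ?_⟩
    · simp only [norm_div, div_pow, ← Finset.sum_div, Complex.norm_real, Real.norm_eq_abs, sq_abs,
        hs]
      exact div_self h
    · exact (div_mul_cancel₀ _ (by exact_mod_cast hs0)).symm.trans (mul_comm _ _)

theorem extend_cons {k : ℕ} {e : Fin (k + 1) → Q} (he : Function.Injective e) (b : Fin 2)
    (s : Fin k → Fin 2) (y : Q → Fin 2) :
    Function.extend e (Fin.cons b s : Fin (k + 1) → Fin 2) y =
      Function.extend (e ∘ Fin.succ) s (Function.update y (e 0) b) := by
  have he' : Function.Injective (e ∘ Fin.succ) := he.comp (Fin.succ_injective k)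
  funext q
  by_cases hq : ∃ i, e i = q
  · obtain ⟨i, rfl⟩ := hq
    rw [he.extend_apply]
    induction i using Fin.cases with
    | zero =>
      rw [Function.extend_apply', Function.update_self, Fin.cons_zero]
      rintro ⟨j, hj⟩
      exact Fin.succ_ne_zero j (he hj)
    | succ i =>
      have := he'.extend_apply s (Function.update y (e 0) b) i
      rw [Function.comp_apply] at this
      rw [this, Fin.cons_succ]
  · rw [Function.extend_apply' _ _ _ hq, Function.extend_apply', Function.update_of_ne]
    · rintro rfl; exact hq ⟨0, rfl⟩
    · rintro ⟨j, hj⟩; exact hq ⟨_, hj⟩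

theorem extend_inl_comp {k : ℕ} {W : Type} {e : Fin k → Q} (he : Function.Injective e)
    (s : Fin k → Fin 2) (y : Q → Fin 2) (z : W → Fin 2) :
    Function.extend (Sum.inl ∘ e) s (Sum.elim y z) = Sum.elim (Function.extend e s y) z := by
  have he' : Function.Injective (Sum.inl ∘ e : Fin k → Q ⊕ W) := Sum.inl_injective.comp he
  funext q
  by_cases hq : ∃ i, (Sum.inl ∘ e : Fin k → Q ⊕ W) i = q
  · obtain ⟨i, rfl⟩ := hq
    rw [he'.extend_apply, Function.comp_apply, Sum.elim_inl, he.extend_apply]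
  · rw [Function.extend_apply' _ _ _ hq]
    rcases q with q | q
    · rw [Sum.elim_inl, Sum.elim_inl, Function.extend_apply']
      rintro ⟨i, rfl⟩
      exact hq ⟨i, rfl⟩
    · rfl

theorem cnot_inr_ket {c : Q} (y : Q → Fin 2) (b : Fin 2) :
    (QGate.cnot (Sum.inl c : Q ⊕ Unit) (Sum.inr ()) (by simp)).toMatrix *ᵥ
      ket (Sum.elim y fun _ => b) = ket (Sum.elim y fun _ => b + y c) := by
  rw [QGate.cnot_ket, Sum.update_elim_inr]
  rfl

theorem toffoli_inr_ket {c d : Q} (h : (Sum.inl c : Q ⊕ Unit) ≠ Sum.inl d) (y : Q → Fin 2)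
    (b : Fin 2) :
    (QGate.toffoli (Sum.inl c : Q ⊕ Unit) (Sum.inl d) (Sum.inr ()) h (by simp)
      (by simp)).toMatrix *ᵥ ket (Sum.elim y fun _ => b) =
        ket (Sum.elim y fun _ => b + y c * y d) := by
  rw [QGate.toffoli_ket, Sum.update_elim_inr]
  rfl

/-- Preparation of the unit vector `v` on the qubits `e`, controlled on the qubit `c`. -/
theorem exists_controlled_preparation (k : ℕ) :
    ∀ (Q : Type) [Fintype Q] [DecidableEq Q] (e : Fin k → Q) (_ : Function.Injective e) (c : Q)
      (_ : ∀ i, e i ≠ c) (v : (Fin k → Fin 2) → ℂ) (_ : ∑ s, ‖v s‖ ^ 2 = 1),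
      ∃ M : Matrix (Q → Fin 2) (Q → Fin 2) ℂ, Implementable M (8 * 2 ^ k - 7) ∧
        FixesOff (Set.range e) M ∧ (∀ y, y c = 0 → M *ᵥ ket y = ket y) ∧
        ∀ y, y c = 1 → (∀ i, y (e i) = 0) →
          M *ᵥ ket y = ∑ s, v s • ket (Function.extend e s y) := by
  -- Binary tree on the first bit: a controlled reflection distributes the norms of the two halves
  -- of `v`, and each normalised half is then prepared under its own control. The cost obeys `N (k +
  -- 1) = 2 * N k + 7` with `N 0 = 1`.
  induction k with
  | zero =>
    intro Q _ _ e _ c _ v hv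
    obtain ⟨s₀⟩ : Nonempty (Fin 0 → Fin 2) := inferInstance
    rw [Fintype.sum_subsingleton _ s₀] at hv
    have hu : (starRingEnd ℂ) (v s₀) * v s₀ = 1 := by
      rw [Complex.conj_mul', ← Complex.ofReal_pow, hv, Complex.ofReal_one]
    -- A unit vector on no qubits is a phase; controlled on `c`, it is a diagonal gate on `c`
    -- itself.
    let A : Matrix.unitaryGroup (Fin 2) ℂ := ⟨!![1, 0; 0, v s₀], by
      rw [Matrix.mem_unitaryGroup_iff]
      ext i j
      fin_cases i <;> fin_cases j <;> simp [Matrix.mul_apply, Fin.sum_univ_two, star_apply]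
      rw [mul_comm]; exact hu⟩
    have hA : A.1 = !![1, 0; 0, v s₀] := rfl
    have hk0 : ∀ y : Q → Fin 2, y c = 0 → (QGate.single c A).toMatrix *ᵥ ket y = ket y := by
      intro y hy
      have e : Function.update y c 0 = y := by rw [← hy, Function.update_eq_self]
      rw [QGate.single_ket, hy, hA, Fin.sum_univ_two, e]
      simp
    have hk1 : ∀ y : Q → Fin 2, y c = 1 →
        (QGate.single c A).toMatrix *ᵥ ket y = v s₀ • ket y := by
      intro y hy
      have e : Function.update y c 1 = y := by rw [← hy, Function.update_eq_self]
      rw [QGate.single_ket, hy, hA, Fin.sum_univ_two, e]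
      simp
    refine ⟨_, Implementable.gate (QGate.single c A), ?_, hk0, fun y hy _ => ?_⟩
    · intro x y h q _
      have hxy : x = y := by
        by_contra hne
        apply h
        rw [← mulVec_ket (QGate.single c A).toMatrix]
        rcases Fin.exists_fin_two.1 ⟨y c, rfl⟩ with hy | hy
        · rw [hk0 y hy, ket_apply, if_neg hne]
        · rw [hk1 y hy, Pi.smul_apply, ket_apply, if_neg hne, smul_zero]
      rw [hxy]
    · have e2 : Function.extend e s₀ y = y := by
        funext q
        rw [Function.extend_apply']
        rintro ⟨i, -⟩
        exact i.elim0
      rw [hk1 y hy, Fintype.sum_subsingleton _ s₀, e2]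
  | succ k ih =>
    intro Q _ _ e he c hc v hv
    obtain ⟨a, v₀, ha, hv₀, hav⟩ := exists_smul_unit fun s : Fin k → Fin 2 =>
      v (Fin.cons 0 s : Fin (k + 1) → Fin 2)
    obtain ⟨b, v₁, hb, hv₁, hbv⟩ := exists_smul_unit fun s : Fin k → Fin 2 =>
      v (Fin.cons 1 s : Fin (k + 1) → Fin 2)
    have hsum : ∀ {A : Type} [AddCommMonoid A] (f : (Fin (k + 1) → Fin 2) → A),
        ∑ s, f s = ∑ s, f (Fin.cons 0 s : Fin (k + 1) → Fin 2) +
          ∑ s, f (Fin.cons 1 s : Fin (k + 1) → Fin 2) := fun f => by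
      rw [← (Fin.consEquiv fun _ => Fin 2).sum_comp, Fintype.sum_prod_type, Fin.sum_univ_two]
      rfl
    rw [hsum, ← ha, ← hb] at hv
    let e' : Fin k → Q ⊕ Unit := Sum.inl ∘ (e ∘ Fin.succ)
    have hes : Function.Injective (e ∘ Fin.succ) := he.comp (Fin.succ_injective k)
    have he' : Function.Injective e' := Sum.inl_injective.comp hes
    obtain ⟨R, hR, hRf, hR0, hR1⟩ := exists_controlled_reflection
      (c := (Sum.inl c : Q ⊕ Unit)) (t := Sum.inl (e 0)) (by simpa using (hc 0).symm) hv
    obtain ⟨U₀, hU₀, hU₀f, hU₀0, hU₀1⟩ := ih (Q ⊕ Unit) e' he' (Sum.inr ()) (by simp [e']) v₀ hv₀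
    obtain ⟨U₁, hU₁, hU₁f, hU₁0, hU₁1⟩ := ih (Q ⊕ Unit) e' he' (Sum.inr ()) (by simp [e']) v₁ hv₁
    have hce : (Sum.inl c : Q ⊕ Unit) ≠ Sum.inl (e 0) := by simpa using (hc 0).symm
    let X : QGate (Q ⊕ Unit) := QGate.cnot (Sum.inl c) (Sum.inr ()) (by simp)
    let F : QGate (Q ⊕ Unit) := QGate.toffoli (Sum.inl c) (Sum.inl (e 0)) (Sum.inr ()) hce
      (by simp) (by simp)
    have hX : ∀ (y : Q → Fin 2) (b : Fin 2), X.toMatrix *ᵥ ket (Sum.elim y fun _ => b) =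
      ket (Sum.elim y fun _ => b + y c) := cnot_inr_ket
    have hF : ∀ (y : Q → Fin 2) (b : Fin 2), F.toMatrix *ᵥ ket (Sum.elim y fun _ => b) =
      ket (Sum.elim y fun _ => b + y c * y (e 0)) := toffoli_inr_ket hce
    have hpad : ∀ y : Q → Fin 2, pad Unit y = Sum.elim y fun _ => 0 := fun y => rfl
    have h11 : (1 : Fin 2) + 1 = 0 := rfl
    -- After the reflection the work qubit is set to `c ∧ e 0` by `F`, turned into `c ∧ ¬ e 0` by
    -- `X` for `U₀`, and back by `X` for `U₁`; the last `F` clears it.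
    let V := F.toMatrix * (U₁ * (X.toMatrix * (U₀ * (X.toMatrix * (F.toMatrix * R)))))
    -- Needed for every `y`, not only for cleared targets. `U₀` and `U₁` change neither `c` nor `e
    -- 0`, so the four toggles of the work qubit cancel.
    have hVsupp : ∀ x y, V x (pad Unit y) ≠ 0 → x (Sum.inr ()) = 0 ∧
        ∀ q, q ∉ Set.range e → x (Sum.inl q) = y q := by
      intro x y h
      obtain ⟨z₁, h1, h⟩ := exists_ne_zero_of_mul h
      obtain ⟨z₂, h2, h⟩ := exists_ne_zero_of_mul h
      obtain ⟨z₃, h3, h⟩ := exists_ne_zero_of_mul h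
      obtain ⟨z₄, h4, h⟩ := exists_ne_zero_of_mul h
      obtain ⟨z₅, h5, h⟩ := exists_ne_zero_of_mul h
      obtain ⟨z₆, h6, h7⟩ := exists_ne_zero_of_mul h
      have k1 := eq_of_ne_zero (QGate.toffoli_ket _ _ _ _ _ _ _) h1
      have k2 := hU₁f _ _ h2
      have k3 := eq_of_ne_zero (QGate.cnot_ket _ _ _ _) h3
      have k4 := hU₀f _ _ h4
      have k5 := eq_of_ne_zero (QGate.cnot_ket _ _ _ _) h5
      have k6 := eq_of_ne_zero (QGate.toffoli_ket _ _ _ _ _ _ _) h6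
      have k7 := hRf _ _ h7
      have hr : (Sum.inr () : Q ⊕ Unit) ∉ Set.range e' := by simp [e']
      have hq : ∀ q, (∀ i, e (Fin.succ i) ≠ q) → x (Sum.inl q) = z₆ (Sum.inl q) ∧
          z₁ (Sum.inl q) = z₆ (Sum.inl q) ∧ z₂ (Sum.inl q) = z₆ (Sum.inl q) ∧
          z₃ (Sum.inl q) = z₆ (Sum.inl q) ∧ z₄ (Sum.inl q) = z₆ (Sum.inl q) ∧
          z₅ (Sum.inl q) = z₆ (Sum.inl q) := by
        intro q hq
        have hq' : (Sum.inl q : Q ⊕ Unit) ∉ Set.range e' := by simpa [e'] using hq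
        have e5 : z₅ (Sum.inl q) = z₆ (Sum.inl q) := by rw [k6]; simp
        have e4 : z₄ (Sum.inl q) = z₆ (Sum.inl q) := by rw [k5, ← e5]; simp
        have e3 : z₃ (Sum.inl q) = z₆ (Sum.inl q) := by rw [k4 _ hq', e4]
        have e2 : z₂ (Sum.inl q) = z₆ (Sum.inl q) := by rw [k3, ← e3]; simp
        have e1 : z₁ (Sum.inl q) = z₆ (Sum.inl q) := by rw [k2 _ hq', e2]
        have e0 : x (Sum.inl q) = z₆ (Sum.inl q) := by rw [k1, ← e1]; simp
        exact ⟨e0, e1, e2, e3, e4, e5⟩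
      constructor
      · obtain ⟨-, a1, -, a3, -, a5⟩ := hq c fun i => hc _
        obtain ⟨-, b1, -, b3, -, b5⟩ := hq (e 0) fun i h => Fin.succ_ne_zero i (he h)
        have r6 : z₆ (Sum.inr ()) = 0 := k7 _ (by simp)
        have r5 := congrFun k6 (Sum.inr ())
        have r4 := congrFun k5 (Sum.inr ())
        have r3 := k4 _ hr
        have r2 := congrFun k3 (Sum.inr ())
        have r1 := k2 _ hr
        have r0 := congrFun k1 (Sum.inr ())
        rw [Function.update_self] at r5 r4 r2 r0
        rw [r0, r1, r2, r3, r4, r5, r6, a1, b1, a3, a5]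
        generalize z₆ (Sum.inl c) = u, z₆ (Sum.inl (e 0)) = w
        revert u w; decide
      · intro q hqe
        rw [(hq q fun i h => hqe ⟨_, h⟩).1]
        exact k7 _ (by simpa using fun h => hqe ⟨0, h.symm⟩)
    have hVmul := mul_padMatrix_eq (V := V) fun x y h _ => (hVsupp x y h).1
    have hVket : ∀ (y : Q → Fin 2) (ψ : (Q → Fin 2) → ℂ),
        V *ᵥ ket (pad Unit y) = padMatrix Q Unit *ᵥ ψ →
          V.submatrix (pad Unit) (pad Unit) *ᵥ ket y = ψ := by
      intro y ψ h
      have h1 := congrArg (· *ᵥ ket y) hVmul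
      simp only [← mulVec_mulVec, padMatrix_ket, h] at h1
      have h2 := congrArg ((padMatrix Q Unit)ᴴ *ᵥ ·) h1
      simpa only [mulVec_mulVec, ← Matrix.mul_assoc, conjTranspose_padMatrix_mul, one_mulVec,
        Matrix.one_mul] using h2.symm
    have hV : Implementable V (8 * 2 ^ (k + 1) - 7) := by
      refine ((Implementable.gate F).mul (hU₁.mul ((Implementable.gate X).mul (hU₀.mul
        ((Implementable.gate X).mul ((Implementable.gate F).mul hR)))))).mono ?_
      have := Nat.one_le_two_pow (n := k)
      rw [pow_succ]
      omega
    refine ⟨_, hV.of_pad hVmul, ?_, fun y hy => hVket _ _ ?_, fun y hy hye => hVket _ _ ?_⟩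
    · intro x y h q hq
      exact (hVsupp _ _ h).2 q hq
    · simp only [V, ← mulVec_mulVec, padMatrix_ket]
      rw [hR0 _ (by simpa [pad] using hy), hpad, hF, hX]
      simp only [hy, zero_mul, add_zero]
      rw [hU₀0 _ rfl, hX, hy, add_zero, hU₁0 _ rfl, hF, hy, zero_mul, add_zero]
    · have hext : ∀ (s : Fin k → Fin 2) (z : Q → Fin 2) (q : Q), (∀ i, e (Fin.succ i) ≠ q) →
          Function.extend (e ∘ Fin.succ) s z q = z q := fun s z q hq =>
        Function.extend_apply' _ _ _ (by rintro ⟨i, hi⟩; exact hq i hi)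
      have hc0 : c ≠ e 0 := (hc 0).symm
      have hs0 : ∀ i : Fin k, e i.succ ≠ e 0 := fun i h => Fin.succ_ne_zero i (he h)
      have h0 : V *ᵥ ket (pad Unit y) = (a : ℂ) • ∑ s, v₀ s •
            ket (pad Unit (Function.extend (e ∘ Fin.succ) s y)) +
          (b : ℂ) • ∑ s, v₁ s • ket (pad Unit (Function.extend (e ∘ Fin.succ) s
            (Function.update y (e 0) 1))) := by
        simp only [V, ← mulVec_mulVec]
        rw [hR1 _ (by simpa [pad] using hy) (by simpa [pad] using hye 0)]
        simp only [mulVec_add, mulVec_smul]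
        congr 2
        · rw [hpad, hF, hX, hye 0, hy, mul_zero, add_zero, zero_add, hU₀1 _ rfl
            (fun i => by simpa [e'] using hye i.succ)]
          simp only [mulVec_sum, mulVec_smul, e', extend_inl_comp hes, hX,
            hext _ _ _ fun i => hc i.succ, hy, h11]
          refine Finset.sum_congr rfl fun s _ => ?_
          rw [hU₁0 _ rfl, hF, hext _ _ _ hs0, hye 0, mul_zero, add_zero, hpad]
        · rw [hpad, Sum.update_elim_inl, hF, hX, Function.update_of_ne hc0, Function.update_self,
            hy, mul_one, zero_add, h11, hU₀0 _ rfl, hX, Function.update_of_ne hc0, hy, zero_add,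
            hU₁1 _ rfl (fun i => by
              simpa [e', Function.update_of_ne (hs0 i)] using hye i.succ)]
          simp only [mulVec_sum, mulVec_smul, e', extend_inl_comp hes, hF,
            hext _ _ _ fun i => hc i.succ, hext _ _ _ hs0, Function.update_of_ne hc0,
            Function.update_self, hy, mul_one, h11, hpad]
      have hy0 : Function.update y (e 0) 0 = y := by rw [← hye 0, Function.update_eq_self]
      rw [h0, hsum]
      simp only [hav, hbv, extend_cons he, hy0, mulVec_add, mulVec_sum, mulVec_smul,
        padMatrix_ket, Finset.smul_sum, smul_smul]

end Preparation

/-! ## The selection operator -/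

section Select

variable {A : Type} [Fintype A] [DecidableEq A] {n k : ℕ}

/-- The `l`-th lowest bit of the number in the register `Fin n`, as a function of the state. -/
def systemBit (A : Type) (n l : ℕ) (x : A ⊕ Fin n → Fin 2) : Fin 2 :=
  if h : l < n then x (Sum.inr ⟨l, h⟩) else 0

theorem systemBit_val (l : Fin n) (x : A ⊕ Fin n → Fin 2) :
    systemBit A n l x = x (Sum.inr l) := by
  simp [systemBit]

theorem computes_systemBit {S : Set ((A ⊕ Fin n → Fin 2) → Fin 2)} {l : ℕ} (hl : l < n) :
    Computes S 1 {systemBit A n l} := by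
  refine (Computes.input (Sum.inr ⟨l, hl⟩)).mono subset_rfl le_rfl ?_
  rw [Set.singleton_subset_singleton]
  funext x
  simp [systemBit, hl]

/-- Addition, modulo `2 ^ n`, of a number that depends on the selection qubits. -/
def shift (sel : Fin k → A) (T : (Fin k → Fin 2) → Fin (2 ^ n)) (x : A ⊕ Fin n → Fin 2) :
    A ⊕ Fin n → Fin 2 :=
  Sum.elim (x ∘ Sum.inl) (finFunctionFinEquiv.symm
    (finFunctionFinEquiv (x ∘ Sum.inr) + T (x ∘ Sum.inl ∘ sel)))

/-- The selection qubits are not moved, so the same amount is looked up again and subtracted. This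
is the explicit inverse required by `implementable_perm`. -/
theorem shift_neg (sel : Fin k → A) (T : (Fin k → Fin 2) → Fin (2 ^ n)) (x : A ⊕ Fin n → Fin 2) :
    shift sel (-T) (shift sel T x) = x := by
  have h1 : shift sel T x ∘ Sum.inr = finFunctionFinEquiv.symm
    (finFunctionFinEquiv (x ∘ Sum.inr) + T (x ∘ Sum.inl ∘ sel)) := rfl
  have h2 : shift sel T x ∘ Sum.inl ∘ sel = x ∘ Sum.inl ∘ sel := rfl
  have h3 : shift sel T x ∘ Sum.inl = x ∘ Sum.inl := rfl
  rw [shift, h1, h2, h3, Equiv.apply_symm_apply, Pi.neg_apply, add_neg_cancel_right,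
    Equiv.symm_apply_apply, Sum.elim_comp_inl_inr]

/-- The indicators of the selection strings are computed once; each bit of the amount is then a
selection among constants, followed by the adder. The last summand copies the ancillas. -/
theorem computes_shift (sel : Fin k → A) (T : (Fin k → Fin 2) → Fin (2 ^ n)) :
    Computes ∅ (2 ^ k * (6 * k + 1) + n * (2 ^ k * 5 + 3) + (3 + n * 12) + Fintype.card A)
      (Set.range fun q x => shift sel T x q) := by
  let b : ℕ → (A ⊕ Fin n → Fin 2) → Fin 2 := fun l x =>
    if h : l < n then finFunctionFinEquiv.symm (T (x ∘ Sum.inl ∘ sel)) ⟨l, h⟩ else 0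
  set I := Set.range (indicator (Sum.inl ∘ sel : Fin k → A ⊕ Fin n)) with hI
  have h1 : Computes ∅ (2 ^ k * (6 * k + 1)) I := computes_indicator _
  have h2 : Computes (∅ ∪ I) (n * (2 ^ k * 5 + 3)) (⋃ l ∈ Finset.range n, {b l}) := by
    have h := Computes.biUnion (S := I) (T := fun l => {b l}) (N := 2 ^ k * 5 + 3)
      (Finset.range n) fun l hl => by
        rw [Finset.mem_range] at hl
        have := computes_select (sel := (Sum.inl ∘ sel : Fin k → A ⊕ Fin n)) (S := I) subset_rfl
          (t := fun s _ => finFunctionFinEquiv.symm (T s) ⟨l, hl⟩) fun s => Computes.const _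
        refine this.mono subset_rfl le_rfl ?_
        rw [Set.singleton_subset_singleton]
        funext x
        simp only [b, hl, dif_pos]
    rw [Finset.card_range] at h
    exact h.mono Set.subset_union_right le_rfl subset_rfl
  set B := ⋃ l ∈ Finset.range n, {b l} with hB
  have h3 : Computes (∅ ∪ (I ∪ B)) (3 + n * 12) (⋃ l ∈ Finset.range n,
      {fun x => systemBit A n l x + b l x + carry (fun i => systemBit A n i x)
        (fun i => b i x) l}) :=
    (computes_adder (K := 1) (fun l hl => computes_systemBit hl) fun l hl =>
      (Computes.of_mem (Or.inr (Or.inr (by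
        rw [hB]; exact Set.mem_biUnion (x := l) (by simpa using hl) rfl)))).mono
          subset_rfl (by norm_num) subset_rfl).mono subset_rfl le_rfl subset_rfl
  set R := ⋃ l ∈ Finset.range n, {fun x => systemBit A n l x + b l x +
    carry (fun i => systemBit A n i x) (fun i => b i x) l} with hR
  have h4 : ∀ S, Computes S (Fintype.card A) (Set.range fun (a : A) (x : A ⊕ Fin n → Fin 2) =>
      x (Sum.inl a)) := fun S =>
    (Computes.range fun a => Computes.input (Sum.inl a)).mono subset_rfl (by simp) subset_rfl
  refine (((h1.trans h2).then h3).trans (h4 _)).mono subset_rfl le_rfl ?_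
  rintro _ ⟨q | q, rfl⟩
  · exact Or.inr ⟨q, rfl⟩
  · left
    have hq : (fun x => shift sel T x (Sum.inr q)) = fun x => systemBit A n q x + b q x +
        carry (fun i => systemBit A n i x) (fun i => b i x) q := by
      funext x
      have := finFunctionFinEquiv_adder (x := x ∘ Sum.inr)
        (y := finFunctionFinEquiv.symm (T (x ∘ Sum.inl ∘ sel)))
        (z := fun l => systemBit A n l x + b l x +
          carry (fun i => systemBit A n i x) (fun i => b i x) l)
        (a := fun i => systemBit A n i x) (b := fun i => b i x)
        (fun l => systemBit_val l x) (fun l => by simp [b]) fun l => rfl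
      rw [Equiv.apply_symm_apply] at this
      rw [shift, ← this, Equiv.symm_apply_apply, Sum.elim_inr]
    change (fun x => shift sel T x (Sum.inr q)) ∈ R
    rw [hq, hR]
    exact Set.mem_biUnion (x := (q : ℕ)) (by simp) rfl

theorem implementable_shift (sel : Fin k → A) (T : (Fin k → Fin 2) → Fin (2 ^ n)) :
    Implementable (funMatrix (shift sel T))
      (8 * (2 ^ k * (6 * k + 1) + n * (2 ^ k * 5 + 3) + (3 + n * 12) + Fintype.card A) +
        5 * (Fintype.card A + n)) :=
  (implementable_perm (shift_neg sel T) (computes_shift sel T) (computes_shift sel (-T))).mono (by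
    rw [Fintype.card_sum, Fintype.card_fin]; omega)

/-- The flag of the states whose number is not a node with the local number `κ` selected by the
selection qubits. -/
def offDomain (p numel : ℕ) (sel : Fin k → A) (κ : (Fin k → Fin 2) → Fin (p + 1))
    (x : A ⊕ Fin n → Fin 2) : Fin 2 :=
  if ∃ e < numel, (finFunctionFinEquiv (x ∘ Sum.inr) : ℕ) = p * e + κ (x ∘ Sum.inl ∘ sel)
  then 0 else 1

theorem ite_eq_one_add_mul (P₁ P₂ P₃ P₄ P₅ : Prop) [Decidable P₁] [Decidable P₂] [Decidable P₃]
    [Decidable P₄] [Decidable P₅] [Decidable (P₁ ∧ (P₄ → ¬P₂) ∧ (P₅ → ¬P₃))] :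
    (if P₁ ∧ (P₄ → ¬P₂) ∧ (P₅ → ¬P₃) then (0 : Fin 2) else 1) =
      1 + (if P₁ then 1 else 0) * ((if P₄ then 1 + (if P₂ then 1 else 0) else 1) *
        (if P₅ then 1 + (if P₃ then 1 else 0) else 1)) := by
  have h11 : (1 : Fin 2) + 1 = 0 := rfl
  by_cases h₁ : P₁ <;> by_cases h₂ : P₂ <;> by_cases h₃ : P₃ <;> by_cases h₄ : P₄ <;>
    by_cases h₅ : P₅ <;> simp [h₁, h₂, h₃, h₄, h₅, h11]

/-- The factors of the indicator function of the nodes with the local number `j`. -/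
theorem offDomain_eq {p numel : ℕ} (hp : 1 ≤ p) (hmesh : 2 ^ n = numel * p + 1)
    (sel : Fin k → A) (κ : (Fin k → Fin 2) → Fin (p + 1)) (x : A ⊕ Fin n → Fin 2) (j : ℕ)
    (hj : j = κ (x ∘ Sum.inl ∘ sel)) :
    offDomain p numel sel κ x = 1 + residue p (systemBit A n) n (j : ZMod p) x *
      ((if j = 0 then 1 + indicator Sum.inr (fun _ : Fin n => 1) x else 1) *
        (if j = p then 1 + indicator Sum.inr (fun _ : Fin n => 0) x else 1)) := by
  have hr : residue p (systemBit A n) n (j : ZMod p) x =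
      if ((finFunctionFinEquiv (x ∘ Sum.inr) : ℕ) : ZMod p) = (j : ZMod p) then 1 else 0 := by
    rw [residue, finFunctionFinEquiv_val (x ∘ Sum.inr) (fun l => systemBit A n l x)
      fun l => systemBit_val l x]
    push_cast
    rfl
  have hu : (fun _ : Fin n => (1 : Fin 2)) = x ∘ Sum.inr ↔
      (finFunctionFinEquiv (x ∘ Sum.inr) : ℕ) + 1 = 2 ^ n := by
    rw [finFunctionFinEquiv_eq_last_iff, eq_comm, funext_iff]
  have hz : (fun _ : Fin n => (0 : Fin 2)) = x ∘ Sum.inr ↔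
      (finFunctionFinEquiv (x ∘ Sum.inr) : ℕ) = 0 := by
    rw [finFunctionFinEquiv_eq_zero_iff, eq_comm, funext_iff]
  have h := exists_element_iff hp hmesh (Fin.is_lt (finFunctionFinEquiv (x ∘ Sum.inr)))
    (Nat.lt_succ_iff.1 (κ (x ∘ Sum.inl ∘ sel)).is_lt)
  rw [offDomain, hr, indicator_eq, indicator_eq, if_congr h rfl rfl, ← hj, if_congr hu rfl rfl,
    if_congr hz rfl rfl]
  exact ite_eq_one_add_mul _ _ _ _ _

/-- The residue table and the tests for the two end nodes are shared by all selection strings. Each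
string then adds a bounded number of steps, so `n` multiplies `p` and not `2 ^ k`. -/
theorem computes_offDomain {p numel : ℕ} (hp : 1 ≤ p) (hmesh : 2 ^ n = numel * p + 1)
    (sel : Fin k → A) (κ : (Fin k → Fin 2) → Fin (p + 1)) :
    Computes ∅ (2 ^ k * (6 * k + 1) + (p * 3 + n * (p * 4)) + (n * 12 + 6) + (2 ^ k * 6 + 5))
      {offDomain (n := n) p numel sel κ} := by
  have : NeZero p := ⟨by omega⟩
  set I := Set.range (indicator (Sum.inl ∘ sel : Fin k → A ⊕ Fin n)) with hI
  set R := Set.range (residue p (systemBit A n) n) with hR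
  let u : (A ⊕ Fin n → Fin 2) → Fin 2 := fun x => 1 + indicator Sum.inr (fun _ : Fin n => 1) x
  let z : (A ⊕ Fin n → Fin 2) → Fin 2 := fun x => 1 + indicator Sum.inr (fun _ : Fin n => 0) x
  have h1 : Computes ∅ (2 ^ k * (6 * k + 1)) I := computes_indicator _
  have h2 : Computes (∅ ∪ I) (p * 3 + n * (p * 4)) R :=
    computes_residue (K := 1) fun l hl => computes_systemBit hl
  have h3 : ∀ S, Computes S (n * 12 + 6) ({u} ∪ {z}) := fun S => by
    have hu : ∀ S, Computes S (n * 6 + 3) {u} := fun S =>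
      (Computes.one.add (computes_indicator_singleton Sum.inr _)).mono subset_rfl
        (by omega) subset_rfl
    have hz : ∀ S, Computes S (n * 6 + 3) {z} := fun S =>
      (Computes.one.add (computes_indicator_singleton Sum.inr _)).mono subset_rfl
        (by omega) subset_rfl
    exact ((hu S).trans (hz _)).mono subset_rfl (by omega) subset_rfl
  let t : (Fin k → Fin 2) → (A ⊕ Fin n → Fin 2) → Fin 2 := fun s x =>
    residue p (systemBit A n) n ((κ s : ℕ) : ZMod p) x *
      ((if (κ s : ℕ) = 0 then u else fun _ => 1) x * (if (κ s : ℕ) = p then z else fun _ => 1) x)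
  have h4 : Computes (∅ ∪ (I ∪ R ∪ ({u} ∪ {z}))) (2 ^ k * 6 + 5)
      {fun x => 1 + t (x ∘ Sum.inl ∘ sel) x} := by
    have ht : ∀ s, Computes (∅ ∪ (I ∪ R ∪ ({u} ∪ {z}))) 4 {t s} := fun s => by
      have e1 : Computes (∅ ∪ (I ∪ R ∪ ({u} ∪ {z}))) 0
          {residue p (systemBit A n) n ((κ s : ℕ) : ZMod p)} :=
        Computes.of_mem (Or.inr (Or.inl (Or.inr ⟨_, rfl⟩)))
      have e2 : Computes (∅ ∪ (I ∪ R ∪ ({u} ∪ {z}))) 1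
          {if (κ s : ℕ) = 0 then u else fun _ => 1} := by
        split_ifs
        · exact (Computes.of_mem (Or.inr (Or.inr (Or.inl rfl)))).mono subset_rfl
            (by norm_num) subset_rfl
        · exact Computes.one
      have e3 : Computes (∅ ∪ (I ∪ R ∪ ({u} ∪ {z}))) 1
          {if (κ s : ℕ) = p then z else fun _ => 1} := by
        split_ifs
        · exact (Computes.of_mem (Or.inr (Or.inr (Or.inr rfl)))).mono subset_rfl
            (by norm_num) subset_rfl
        · exact Computes.one
      exact e1.mul (e2.mul e3)
    exact (Computes.one.add (computes_select (sel := (Sum.inl ∘ sel : Fin k → A ⊕ Fin n))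
      (fun f hf => Or.inr (Or.inl (Or.inl hf))) ht)).mono subset_rfl (by omega) subset_rfl
  have hd : offDomain (n := n) p numel sel κ = fun x => 1 + t (x ∘ Sum.inl ∘ sel) x := by
    funext x
    rw [offDomain_eq hp hmesh sel κ x _ rfl]
    simp only [t, u, z, apply_ite (fun f : (A ⊕ Fin n → Fin 2) → Fin 2 => f x)]
  rw [hd]
  exact (((h1.trans h2).trans (h3 _)).then h4).mono subset_rfl le_rfl subset_rfl

/-- The selection operator: flag the numbers outside of the domain, then shift. -/
def select (p numel : ℕ) (sel : Fin k → A) (t : A) (κ : (Fin k → Fin 2) → Fin (p + 1))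
    (T : (Fin k → Fin 2) → Fin (2 ^ n)) (x : A ⊕ Fin n → Fin 2) : A ⊕ Fin n → Fin 2 :=
  shift sel T (Function.update x (Sum.inl t)
    (x (Sum.inl t) + offDomain p numel sel κ x))

theorem implementable_select {p numel : ℕ} (hp : 1 ≤ p) (hmesh : 2 ^ n = numel * p + 1)
    {sel : Fin k → A} {t : A} (ht : ∀ i, sel i ≠ t) (κ : (Fin k → Fin 2) → Fin (p + 1))
    (T : (Fin k → Fin 2) → Fin (2 ^ n)) :
    Implementable (funMatrix (select p numel sel t κ T))
      ((8 * (2 ^ k * (6 * k + 1) + n * (2 ^ k * 5 + 3) + (3 + n * 12) + Fintype.card A) +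
        5 * (Fintype.card A + n)) + (8 * (2 ^ k * (6 * k + 1) + (p * 3 + n * (p * 4)) +
          (n * 12 + 6) + (2 ^ k * 6 + 5)) + 3)) := by
  have h := (implementable_shift sel T).mul (implementable_update
    (computes_offDomain hp hmesh sel κ) (Sum.inl t) fun x b => by
      have h1 : Function.update x (Sum.inl t) b ∘ Sum.inr = x ∘ Sum.inr := by
        funext l; simp
      have h2 : Function.update x (Sum.inl t) b ∘ Sum.inl ∘ sel = x ∘ Sum.inl ∘ sel := by
        funext i; simp [ht i]
      rw [offDomain, offDomain, h1, h2])
  rwa [funMatrix_mul] at h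

/-- A number off the domain raises the flag, which is then orthogonal to every `w s'`; on the domain
the ancillas are unchanged, and comparing them on `sel` gives `s' = s`. -/
theorem select_eq_iff {p numel : ℕ} {sel : Fin k → A} {t : A} (ht : ∀ i, sel i ≠ t)
    (κ : (Fin k → Fin 2) → Fin (p + 1)) (T : (Fin k → Fin 2) → Fin (2 ^ n))
    {w : (Fin k → Fin 2) → A → Fin 2} (hw : ∀ s, w s ∘ sel = s) (hwt : ∀ s, w s t = 0)
    (s s' : Fin k → Fin 2) (i i' : Fin (2 ^ n)) :
    (Sum.elim (w s') (finFunctionFinEquiv.symm i') : A ⊕ Fin n → Fin 2) =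
        select p numel sel t κ T (Sum.elim (w s) (finFunctionFinEquiv.symm i)) ↔
      s' = s ∧ (∃ e < numel, (i : ℕ) = p * e + κ s) ∧ i' = i + T s := by
  have h1 : offDomain p numel sel κ (Sum.elim (w s) (finFunctionFinEquiv.symm i)) =
      if ∃ e < numel, (i : ℕ) = p * e + κ s then 0 else 1 := by
    rw [offDomain, Sum.elim_comp_inr, Equiv.apply_symm_apply, ← Function.comp_assoc,
      Sum.elim_comp_inl, hw]
  have h2 : (Function.update (w s) t (if ∃ e < numel, (i : ℕ) = p * e + κ s then 0 else 1)) ∘ sel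
      = s := by
    rw [← hw s]
    funext j
    simp [ht j, hw]
  rw [select, Sum.elim_inl, h1, hwt, zero_add, Sum.update_elim_inl, shift, Sum.elim_comp_inl,
    Sum.elim_comp_inr, ← Function.comp_assoc, Sum.elim_comp_inl, h2, Equiv.apply_symm_apply,
    Sum.elim_eq_iff, finFunctionFinEquiv.symm.injective.eq_iff, ← and_assoc]
  refine and_congr_left fun _ => ⟨fun h => ?_, ?_⟩
  · have h3 := congrArg (· ∘ sel) h
    have h4 := congrFun h t
    simp only [hw, h2] at h3
    rw [hwt, Function.update_self] at h4
    refine ⟨h3, ?_⟩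
    by_contra hne
    rw [if_neg hne] at h4
    exact absurd h4 (by decide)
  · rintro ⟨rfl, hD⟩
    rw [if_pos hD, ← hwt s', Function.update_eq_self]

end Select

/-! ## Linear combination of unitaries -/

section LCU

theorem conjTranspose_mul_apply_ket {X : Type} [Fintype X] [DecidableEq X] (M N : Matrix X X ℂ)
    (x y : X) : (Mᴴ * N) x y = star (M *ᵥ ket x) ⬝ᵥ (N *ᵥ ket y) := by
  rw [Matrix.mul_apply, dotProduct]
  simp only [conjTranspose_apply, Pi.star_apply, mulVec_ket]

theorem star_ket_dotProduct_ket {X : Type} [Fintype X] [DecidableEq X] (x y : X) :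
    star (ket x) ⬝ᵥ ket y = if x = y then 1 else 0 := by
  rw [dotProduct]
  simp [ket_apply, eq_comm]

/-- Square roots of the coefficients of a linear combination. -/
theorem exists_sqrt_coefficients {ι : Type} [Fintype ι] (w : ι → ℂ) {α : ℝ} (hα : 0 < α)
    (hw : ∑ i, ‖w i‖ = α) :
    ∃ u v : ι → ℂ, ∑ i, ‖u i‖ ^ 2 = 1 ∧ ∑ i, ‖v i‖ ^ 2 = 1 ∧
      ∀ i, (α : ℂ) * (star (u i) * v i) = w i := by
  have hsq : ∀ i, Real.sqrt (‖w i‖ / α) ^ 2 = ‖w i‖ / α := fun i =>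
    Real.sq_sqrt (by positivity)
  have hsum : ∑ i, ‖w i‖ / α = 1 := by
    rw [← Finset.sum_div, hw, div_self hα.ne']
  have hphase : ∀ i, ∃ z : ℂ, ‖z‖ = 1 ∧ w i = ‖w i‖ * z := fun i =>
    ⟨Complex.exp (Complex.arg (w i) * Complex.I), Complex.norm_exp_ofReal_mul_I _,
      (Complex.norm_mul_exp_arg_mul_I _).symm⟩
  choose z hz1 hz2 using hphase
  -- The modulus is shared equally between `u` and `v`, and the whole phase is given to `v`.
  refine ⟨fun i => (Real.sqrt (‖w i‖ / α) : ℝ), fun i => (Real.sqrt (‖w i‖ / α) : ℝ) * z i,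
    ?_, ?_, fun i => ?_⟩
  · simpa only [Complex.norm_real, Real.norm_eq_abs, sq_abs, hsq] using hsum
  · simpa only [norm_mul, hz1, mul_one, Complex.norm_real, Real.norm_eq_abs, sq_abs, hsq] using hsum
  · have h := congrArg (fun x : ℝ => (x : ℂ)) (hsq i)
    push_cast at h
    rw [Complex.star_def, Complex.conj_ofReal, ← mul_assoc, ← mul_assoc, mul_assoc (α : ℂ), ← sq, h,
      mul_div_cancel₀ _ (by exact_mod_cast hα.ne')]
    exact (hz2 i).symm

variable {A : Type} [Fintype A] [DecidableEq A] {n k : ℕ}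

/-- State preparation on clean ancillas, one of which serves as the control. -/
theorem exists_preparation {sel : Fin k → A} (hsel : Function.Injective sel) {c : A}
    (hc : ∀ i, sel i ≠ c) {v : (Fin k → Fin 2) → ℂ} (hv : ∑ s, ‖v s‖ ^ 2 = 1) :
    ∃ M : Matrix (A ⊕ Fin n → Fin 2) (A ⊕ Fin n → Fin 2) ℂ, Implementable M (8 * 2 ^ k) ∧
      ∀ x : Fin n → Fin 2, M *ᵥ ket (Sum.elim 0 x) =
        ∑ s, v s • ket (Sum.elim (Function.extend sel s (Function.update 0 c 1)) x) := by
  obtain ⟨M, h1, -, -, h2⟩ := exists_controlled_preparation k (A ⊕ Fin n) (Sum.inl ∘ sel)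
    (Sum.inl_injective.comp hsel) (Sum.inl c) (by simpa using hc) v hv
  -- A NOT switches the control on. It stays on in the prepared state; both preparations do this, so
  -- their inner product is unaffected.
  refine ⟨_, (h1.mul (Implementable.gate (QGate.single (Sum.inl c) notUnitary))).mono ?_,
    fun x => ?_⟩
  · have := Nat.one_le_two_pow (n := k)
    omega
  · rw [← mulVec_mulVec, QGate.not_ket, Sum.update_elim_inl]
    simp only [Sum.elim_inl, Pi.zero_apply, zero_add]
    rw [h2 _ (by simp) fun i => by simp [hc i]]
    simp only [extend_inl_comp hsel]

/-- `U = Lᴴ * S * R`, and its entry on clean ancillas is the inner product of the states prepared by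
`L` and by `S * R`, a double sum over strings that `select_eq_iff` makes diagonal. -/
theorem exists_lcu {p numel : ℕ} (hp : 1 ≤ p) (hmesh : 2 ^ n = numel * p + 1)
    {sel : Fin k → A} (hsel : Function.Injective sel) {t c : A} (ht : ∀ i, sel i ≠ t)
    (hc : ∀ i, sel i ≠ c) (htc : t ≠ c) (κ : (Fin k → Fin 2) → Fin (p + 1))
    (T : (Fin k → Fin 2) → Fin (2 ^ n)) (w : (Fin k → Fin 2) → ℂ) {α : ℝ} (hα : 0 < α)
    (hw : ∑ s, ‖w s‖ = α) :
    ∃ U : Matrix (A ⊕ Fin n → Fin 2) (A ⊕ Fin n → Fin 2) ℂ,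
      Implementable U (8 * 2 ^ k + (((8 * (2 ^ k * (6 * k + 1) + n * (2 ^ k * 5 + 3) +
        (3 + n * 12) + Fintype.card A) + 5 * (Fintype.card A + n)) + (8 * (2 ^ k * (6 * k + 1) +
          (p * 3 + n * (p * 4)) + (n * 12 + 6) + (2 ^ k * 6 + 5)) + 3)) + 8 * 2 ^ k)) ∧
      ∀ i' i : Fin (2 ^ n), (α : ℂ) * U (Sum.elim 0 (finFunctionFinEquiv.symm i'))
        (Sum.elim 0 (finFunctionFinEquiv.symm i)) =
          ∑ s, w s * if (∃ e < numel, (i : ℕ) = p * e + κ s) ∧ i' = i + T s then 1 else 0 := by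
  obtain ⟨u, v, hu, hv, huv⟩ := exists_sqrt_coefficients w hα hw
  obtain ⟨L, hL, hLk⟩ := exists_preparation (n := n) hsel hc hu
  obtain ⟨R, hR, hRk⟩ := exists_preparation (n := n) hsel hc hv
  refine ⟨_, hL.conjTranspose.mul ((implementable_select hp hmesh ht κ T).mul hR),
    fun i' i => ?_⟩
  have hx : ∀ s : Fin k → Fin 2, Function.extend sel s (Function.update 0 c 1) ∘ sel = s :=
    fun s => funext fun i => hsel.extend_apply _ _ i
  have hxt : ∀ s : Fin k → Fin 2, Function.extend sel s (Function.update 0 c 1) t = 0 := by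
    intro s
    rw [Function.extend_apply' _ _ _ (by rintro ⟨i, hi⟩; exact ht i hi),
      Function.update_of_ne htc]
    rfl
  rw [conjTranspose_mul_apply_ket, hLk, ← mulVec_mulVec, hRk]
  simp only [mulVec_sum, mulVec_smul, funMatrix_mulVec_ket, star_sum, star_smul, sum_dotProduct,
    dotProduct_sum, smul_dotProduct, dotProduct_smul, star_ket_dotProduct_ket,
    select_eq_iff ht κ T hx hxt, Finset.mul_sum, smul_eq_mul]
  refine Finset.sum_congr rfl fun s _ => ?_
  rw [Finset.sum_eq_single s]
  · rw [← huv]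
    simp only [true_and]
    ring
  · intro s' _ hne
    rw [if_neg fun h => hne h.1]
    simp
  · simp

end LCU

/-! ## The block-encoding -/

/-- As `p ≥ 1`, a node and its local number determine the element, so the sum over elements has at
most one nonzero term. -/
theorem globalArray_lagrangeIX_apply {p numel N : ℕ} (hp : 1 ≤ p) (h : N = numel * p + 1)
    (Ae : Matrix (Fin (p + 1)) (Fin (p + 1)) ℂ) (i' i : Fin N) :
    globalArray (lagrangeIX h) Ae i' i = ∑ a : Fin (p + 1) × Fin (p + 1), Ae a.1 a.2 *
      if ∃ e < numel, (i : ℕ) = p * e + a.2 ∧ (i' : ℕ) = p * e + a.1 then 1 else 0 := by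
  rw [Fintype.sum_prod_type, globalArray, Matrix.sum_apply]
  refine Finset.sum_congr rfl fun j _ => ?_
  rw [Matrix.sum_apply]
  refine Finset.sum_congr rfl fun k _ => ?_
  rw [Matrix.smul_apply, smul_eq_mul, unitOfInteraction, Matrix.sum_apply]
  congr 1
  simp only [Matrix.single_apply, lagrangeIX, Fin.ext_iff]
  split_ifs with hex
  · obtain ⟨e, he, h1, h2⟩ := hex
    rw [Finset.sum_eq_single ⟨e, he⟩]
    · rw [if_pos ⟨h2.symm, h1.symm⟩]
    · intro e' _ hne
      refine if_neg fun ⟨h3, _⟩ => hne (Fin.ext ?_)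
      rw [h2] at h3
      exact Nat.eq_of_mul_eq_mul_left hp (Nat.add_right_cancel h3)
    · simp
  · refine Finset.sum_eq_zero fun e _ => if_neg fun ⟨h1, h2⟩ => hex ⟨e, e.isLt, h2.symm, h1.symm⟩

/-- `N - k` stands for `-k` modulo `N`. It is not truncated since `k ≤ i < N`, and the target `p * e
+ j` does not wrap around. -/
theorem add_ofNat_eq_iff {N p e j k : ℕ} [NeZero N] {i i' : Fin N} (hi : (i : ℕ) = p * e + k)
    (hj : p * e + j < N) :
    i' = i + Fin.ofNat N (j + (N - k)) ↔ (i' : ℕ) = p * e + j := by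
  have hk := i.isLt
  rw [Fin.ext_iff, Fin.val_add, Fin.val_ofNat, Nat.add_mod_mod, hi,
    show p * e + k + (j + (N - k)) = p * e + j + N by omega, Nat.add_mod_right,
    Nat.mod_eq_of_lt hj]

theorem theorem3p3 :
    ∃ C : ℕ, ∀ (n p numel : ℕ) (_hp : 1 ≤ p) (_hnumel : 1 ≤ numel)
      (hmesh : 2 ^ n = numel * p + 1)
      (Ae : Matrix (Fin (p + 1)) (Fin (p + 1)) ℂ) (_hAe : Ae ≠ 0) (m : ℕ)
      (_hm : m = Nat.clog 2 (p + 1)),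
      ∃ (w : ℕ) (c : QCircuit ((Fin (4 * m + 3) ⊕ Fin n) ⊕ Fin w))
        (U : Matrix (Fin (4 * m + 3) ⊕ Fin n → Fin 2) (Fin (4 * m + 3) ⊕ Fin n → Fin 2) ℂ),
        c.Implements U ∧
        IsBlockEncoding (∑ j, ∑ k, ‖Ae j k‖) (4 * m + 3)
          (globalArray (lagrangeIX hmesh) Ae) U ∧
        c.length ≤ C * (n * m * (p + 1) ^ 2) := by
  -- Not tight: once every term is bounded by `n * m * (p + 1) ^ 2`, the coefficients add up to less
  -- than 2000.
  refine ⟨10000, fun n p numel hp hnumel hmesh Ae hAe m hm => ?_⟩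
  have hpm : p + 1 ≤ 2 ^ m := by rw [hm]; exact Nat.le_pow_clog (by norm_num) _
  have hm1 : 1 ≤ m := by rw [hm]; exact Nat.clog_pos (by norm_num) (by omega)
  have hmp : 2 ^ m ≤ 2 * (p + 1) := by
    have h1 : 2 ^ (m - 1) < p + 1 := by
      rw [hm]; exact Nat.pow_pred_clog_lt_self (by norm_num) (by omega)
    have h2 : 2 ^ m = 2 ^ (m - 1) * 2 := by rw [← pow_succ, Nat.sub_add_cancel hm1]
    omega
  have hn1 : 1 ≤ n := by
    rcases Nat.eq_zero_or_pos n with rfl | h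
    · have := Nat.mul_le_mul hnumel hp
      simp at hmesh
      omega
    · exact h
  -- Any injective coding of the pairs by strings of `2 * m` bits will do.
  obtain ⟨enc⟩ : Nonempty (Fin (p + 1) × Fin (p + 1) ↪ (Fin (2 * m) → Fin 2)) := by
    apply Function.Embedding.nonempty_of_card_le
    simp only [Fintype.card_prod, Fintype.card_fun, Fintype.card_fin]
    calc (p + 1) * (p + 1) ≤ 2 ^ m * 2 ^ m := Nat.mul_le_mul hpm hpm
      _ = 2 ^ (2 * m) := by rw [two_mul, pow_add]
  let dec := Function.invFun enc
  have hdec : ∀ a, dec (enc a) = a := Function.leftInverse_invFun enc.injective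
  -- Ancilla layout: `2 * m` selection qubits, then the flag `t`, then the control `c`; the others
  -- stay idle.
  let sel : Fin (2 * m) → Fin (4 * m + 3) := Fin.castLE (by omega)
  have hsel : Function.Injective sel := Fin.castLE_injective _
  let t : Fin (4 * m + 3) := ⟨2 * m, by omega⟩
  let c : Fin (4 * m + 3) := ⟨2 * m + 1, by omega⟩
  have ht : ∀ i, sel i ≠ t := fun i h => by
    have := congrArg Fin.val h
    simp [sel, t] at this
    omega
  have hc : ∀ i, sel i ≠ c := fun i h => by
    have := congrArg Fin.val h
    simp [sel, c] at this
    omega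
  have htc : t ≠ c := fun h => by
    have := congrArg Fin.val h
    simp [t, c] at this
  -- The translation by `j - k` modulo `2 ^ n`, for the pair `(j, k)` coded by `s`.
  let T : (Fin (2 * m) → Fin 2) → Fin (2 ^ n) := fun s =>
    Fin.ofNat _ ((dec s).1 + (2 ^ n - (dec s).2))
  -- Strings that code no pair get weight zero, so the arbitrary value of `dec` there is harmless
  -- and `α` is unchanged.
  let w : (Fin (2 * m) → Fin 2) → ℂ := fun s =>
    if enc (dec s) = s then Ae (dec s).1 (dec s).2 else 0
  have hwe : ∀ a, w (enc a) = Ae a.1 a.2 := fun a => by simp only [w, hdec, if_true]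
  have hw0 : ∀ s, s ∉ Set.range enc → w s = 0 := fun s hs =>
    if_neg fun h => hs ⟨_, h⟩
  have hw : ∑ s, ‖w s‖ = ∑ j, ∑ k, ‖Ae j k‖ := by
    rw [← Fintype.sum_prod_type' fun j k => ‖Ae j k‖]
    exact (Fintype.sum_of_injective enc enc.injective _ _ (fun s hs => by rw [hw0 s hs, norm_zero])
      fun a => by rw [hwe]).symm
  have hα : 0 < ∑ j, ∑ k, ‖Ae j k‖ := by
    obtain ⟨j, k, hjk⟩ : ∃ j k, Ae j k ≠ 0 := by
      by_contra! h
      exact hAe (Matrix.ext h)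
    exact Finset.sum_pos' (fun j _ => Finset.sum_nonneg fun k _ => norm_nonneg _)
      ⟨j, Finset.mem_univ _, Finset.sum_pos' (fun k _ => norm_nonneg _)
        ⟨k, Finset.mem_univ _, norm_pos_iff.2 hjk⟩⟩
  obtain ⟨U, ⟨W, C, hCU, hlen⟩, hU⟩ := exists_lcu hp hmesh hsel ht hc htc (fun s => (dec s).2) T w
    hα hw
  refine ⟨W, C, U, hCU, ⟨hα, ?_, ?_⟩, hlen.trans ?_⟩
  · rw [Matrix.mem_unitaryGroup_iff']
    exact hCU.conjTranspose_mul
  · ext i' i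
    rw [Matrix.smul_apply, smul_eq_mul, Matrix.submatrix_apply]
    refine Eq.trans ?_ (hU i' i).symm
    rw [globalArray_lagrangeIX_apply hp hmesh]
    refine Fintype.sum_of_injective enc enc.injective _ _
      (fun s hs => by rw [hw0 s hs, zero_mul]) fun a => ?_
    rw [hwe, hdec]
    congr 1
    refine if_congr ?_ rfl rfl
    have hlt : ∀ e < numel, p * e + a.1 < 2 ^ n := fun e he => by
      have h1 := Nat.mul_le_mul_left p (Nat.succ_le_of_lt he)
      have h2 := a.1.isLt
      rw [Nat.mul_succ, mul_comm p numel] at h1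
      omega
    simp only [T, hdec]
    constructor
    · rintro ⟨e, he, h1, h2⟩
      exact ⟨⟨e, he, h1⟩, (add_ofNat_eq_iff h1 (hlt e he)).2 h2⟩
    · rintro ⟨⟨e, he, h1⟩, h2⟩
      exact ⟨e, he, h1, (add_ofNat_eq_iff h1 (hlt e he)).1 h2⟩
  · rw [Fintype.card_fin]
    have hP : 2 ^ (2 * m) ≤ 4 * (p + 1) ^ 2 := by
      calc 2 ^ (2 * m) = 2 ^ m * 2 ^ m := by rw [two_mul, pow_add]
        _ ≤ (2 * (p + 1)) * (2 * (p + 1)) := Nat.mul_le_mul hmp hmp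
        _ = 4 * (p + 1) ^ 2 := by ring
    have hpP : p ≤ (p + 1) ^ 2 := by nlinarith
    have hP1 : 1 ≤ (p + 1) ^ 2 := Nat.one_le_pow _ _ (by omega)
    -- With the powers made opaque, every monomial of the count is compared with `n * m * Y`, using
    -- that `n`, `m` and `Y` are at least `1`.
    generalize (p + 1) ^ 2 = Y at *
    generalize 2 ^ (2 * m) = P at *
    have e1 : Y * m ≤ n * m * Y := by nlinarith [Nat.mul_le_mul hn1 (le_refl (Y * m))]
    have e2 : n * Y ≤ n * m * Y := by nlinarith [Nat.mul_le_mul hm1 (le_refl (n * Y))]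
    have e3 : Y ≤ n * Y := by nlinarith
    have e4 : n ≤ n * Y := by nlinarith
    have e5 : m ≤ Y * m := by nlinarith
    have e6 : P * m ≤ 4 * Y * m := Nat.mul_le_mul_right m hP
    have e7 : n * P ≤ n * (4 * Y) := Nat.mul_le_mul_left n hP
    have e8 : n * p ≤ n * Y := Nat.mul_le_mul_left n hpP
    linarith
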